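/- **Setting.** A BMS channel $P$ has input alphabet $\{0,1\}$, an output alphabet $\mathcal Y$ carrying a $\sigma$-finite reference measure $\nu$ (counting measure if $P$ is discrete, so that integrals are sums), transition probabilities (densities with respect to $\nu$) $P(y|x)$, and a $\nu$-preserving involution $\pi$ of $\mathcal Y$ with $P(y|1)=P(\pi(y)|0)$. Put $$Z(P)=\int\sqrt{P(y|0)P(y|1)}\,d\nu(y),\qquad I(P)=\int\sum_{x}\tfrac12P(y|x)\log_2\frac{P(y|x)}{\frac12P(y|0)+\frac12P(y|1)}\,d\nu(y),$$ $$P^-(y_1,y_2|x_1)=\sum_{x_2}\tfrac12P(y_1|x_1\oplus x_2)P(y_2|x_2),\qquad P^+(y_1,y_2,x_1|x_2)=\tfrac12P(y_1|x_1\oplus x_2)P(y_2|x_2).$$ The polarization tree of $W$ has $W$ at the root and $P^-$, $P^+$ as left and right child of $P$; $W_N^{(1)},\dots,W_N^{(N)}$ are the $N=2^n$ channels at level $n$, from left to right. A quantization scheme $Q_k$ assigns to every BMS channel a BMS channel with at most $k$ output symbols. The quantized tree has $\tilde W=Q_k(W)$ at the root, and the children of a node $\tilde P$ are $Q_k(\tilde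 P^-)$ and $Q_k(\tilde P^+)$; its channels at level $n$ are $\tilde W_N^{(i)}$. $Q_k$ is *admissible* if $Z(\tilde W_N^{(i)})\ge Z(W_N^{(i)})$ for all BMS channels $W$, all $n$ and all $i$. Put $$\rho(Q_k,W)=\lim_{n\to\infty}\frac{|\{i: I(\tilde W_N^{(i)})>\frac12\}|}{N}.$$ **Mass algorithms.** A BMS channel with finite output alphabet is described by a list $(p_1,x_1),\dots,(p_m,x_m)$ with $p_i>0$, $\sum_i p_i=1$, $0\le x_1<\dots<x_m\le\frac12$: with probability $p_i$ the input is sent over a binary symmetric channel with crossover probability $x_i$. Let $f$ be an increasing function on $[0,\frac12]$. The *mass transportation algorithm* repeats: choose $j$ minimizing $p_i(f(x_{i+1})-f(x_i))$ and replace $(p_j,x_j),(p_{j+1},x_{j+1})$ by $(p_j+p_{j+1},x_{j+1})$. The *mass merging algorithm*, for $f$ increasing and concave, repeats: choose $j$ minimizing $p_i(f(\bar x_i)-f(x_i))-p_{i+1}(f(x_{i+1})-f(\bar x_i))$, where $\bar x_i=\frac{p_ix_i+p_{i+1}x_{i+1}}{p_i+p_{i+1}}$, and replace $(p_j,x_j),(p_{j+1},x_{j+1})$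 by $(p_j+p_{j+1},\bar x_j)$. Either one stops when at most $\lfloor k/2\rfloor$ masses, that is at most $k$ output symbols, are left; ties are broken by the smallest $j$. **Theorem.** Let $W$ be a BMS channel, fix one of the two algorithms and a function $f$ as above, and let $\varepsilon>0$. There is $\delta_0>0$ such that for every $\delta\in(0,\delta_0]$ there is $K$ such that for every $k\ge K$ there is an admissible quantization scheme $Q_k$ with the following properties: $Q_k(P)=\mathrm{BEC}(Z(P))$ for every BMS channel $P$ with $Z(P)<\delta$; $Q_k(P)$ is the output of the algorithm for every BMS channel $P$ with finite output alphabet and $Z(P)\ge\delta$; the limit $\rho(Q_k,W)$ exists; and $$|\rho(Q_k,W)-I(W)|<\varepsilon .$$ -/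

import Mathlib

open MeasureTheory Set Filter Topology

noncomputable section

/-- A binary-input memoryless symmetric channel.  Its transition law is given by densities
`w x y = P(y | x)` with respect to a σ-finite reference measure `ν` on the output alphabet
(counting measure for discrete channels).  Symmetry: a `ν`-preserving involution `π` of the
output alphabet exchanges the two conditional laws. -/
structure BMS where
  Y : Type
  [mY : MeasurableSpace Y]
  ν : Measure Y
  [sigmaFinite : SigmaFinite ν]
  w : Bool → Y → ℝ
  measurable_w : ∀ x, Measurable (w x)
  w_nonneg : ∀ x y, 0 ≤ w x y
  integral_w : ∀ x, ∫ y, w x y ∂ν = 1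
  π : Y → Y
  π_invol : Function.Involutive π
  π_preserving : MeasurePreserving π ν ν
  w_symm : ∀ x y, w (!x) y = w x (π y)

attribute [instance] BMS.mY BMS.sigmaFinite

namespace BMS

theorem integrable_w (P : BMS) (x : Bool) : Integrable (P.w x) P.ν := by
  by_contra h
  have := P.integral_w x
  rw [integral_undef h] at this
  exact zero_ne_one this

/-- Bhattacharyya parameter `Z(P)`. -/
def Z (P : BMS) : ℝ := ∫ y, Real.sqrt (P.w false y * P.w true y) ∂P.ν

/-- Mutual information in bits between a uniform input and the output
(the symmetric capacity `I(P)`). -/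
def I (P : BMS) : ℝ :=
  ∫ y, ∑ x : Bool, 1 / 2 * P.w x y *
    Real.logb 2 (P.w x y / (1 / 2 * P.w false y + 1 / 2 * P.w true y)) ∂P.ν

theorem Z_nonneg (P : BMS) : 0 ≤ P.Z := integral_nonneg fun _ => Real.sqrt_nonneg _

theorem Z_le_one (P : BMS) : P.Z ≤ 1 := by
  have h : ∫ y, (P.w false y + P.w true y) / 2 ∂P.ν = 1 := by
    rw [integral_div, integral_add (P.integrable_w _) (P.integrable_w _), P.integral_w,
      P.integral_w]
    norm_num
  rw [← h]
  refine integral_mono_of_nonneg (Eventually.of_forall fun _ => Real.sqrt_nonneg _)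
    (((P.integrable_w _).add (P.integrable_w _)).div_const 2)
    (Eventually.of_forall fun y => ?_)
  have h0 := P.w_nonneg false y
  have h1 := P.w_nonneg true y
  refine Real.sqrt_le_iff.2 ⟨by positivity, ?_⟩
  nlinarith [sq_nonneg (P.w false y - P.w true y)]

/-- `P⁻(y₁, y₂ | x₁) = ∑_{x₂} ½ P(y₁ | x₁ ⊕ x₂) P(y₂ | x₂)`. -/
def minus (P : BMS) : BMS where
  Y := P.Y × P.Y
  ν := P.ν.prod P.ν
  w x₁ y := ∑ x₂ : Bool, 1 / 2 * P.w (xor x₁ x₂) y.1 * P.w x₂ y.2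
  measurable_w x₁ := by
    refine Finset.measurable_sum _ fun x₂ _ => ?_
    exact (((P.measurable_w _).comp measurable_fst).const_mul _).mul
      ((P.measurable_w _).comp measurable_snd)
  w_nonneg x₁ y := Finset.sum_nonneg fun x₂ _ =>
    mul_nonneg (mul_nonneg (by norm_num) (P.w_nonneg _ _)) (P.w_nonneg _ _)
  integral_w x₁ := by
    rw [integral_finsetSum]
    · have h : ∀ x₂ : Bool, ∫ y : P.Y × P.Y, 1 / 2 * P.w (xor x₁ x₂) y.1 * P.w x₂ y.2
          ∂(P.ν.prod P.ν) = 1 / 2 := fun x₂ => by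
        rw [integral_prod_mul (fun y => 1 / 2 * P.w (xor x₁ x₂) y) (P.w x₂),
          integral_const_mul, P.integral_w, P.integral_w]
        norm_num
      simp only [h]
      norm_num
    · intro x₂ _
      exact Integrable.mul_prod ((P.integrable_w _).const_mul _) (P.integrable_w _)
  π := fun y => (P.π y.1, y.2)
  π_invol := fun y => by simp [P.π_invol y.1]
  π_preserving := P.π_preserving.prod (MeasurePreserving.id _)
  w_symm x₁ y := by
    refine Finset.sum_congr rfl fun x₂ _ => ?_
    rw [← P.w_symm]
    simp

/-- `P⁺(y₁, y₂, x₁ | x₂) = ½ P(y₁ | x₁ ⊕ x₂) P(y₂ | x₂)`. -/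
def plus (P : BMS) : BMS where
  Y := P.Y × P.Y × Bool
  ν := P.ν.prod (P.ν.prod Measure.count)
  w x₂ y := 1 / 2 * P.w (xor y.2.2 x₂) y.1 * P.w x₂ y.2.1
  measurable_w x₂ := by
    have h : Measurable fun y : P.Y × P.Y × Bool => P.w (xor y.2.2 x₂) y.1 := by
      have : Measurable fun q : Bool × P.Y => P.w (xor q.1 x₂) q.2 :=
        measurable_from_prod_countable_right fun b => P.measurable_w (xor b x₂)
      exact this.comp ((measurable_snd.comp measurable_snd).prodMk measurable_fst)
    exact (h.const_mul _).mul
      ((P.measurable_w _).comp (measurable_fst.comp measurable_snd))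
  w_nonneg x₂ y := mul_nonneg (mul_nonneg (by norm_num) (P.w_nonneg _ _)) (P.w_nonneg _ _)
  integral_w x₂ := by
    have e : ∀ y : P.Y × P.Y × Bool, 1 / 2 * P.w (xor y.2.2 x₂) y.1 * P.w x₂ y.2.1 =
        ∑ b : Bool, (1 / 2 * P.w (xor b x₂) y.1) *
          (P.w x₂ y.2.1 * if y.2.2 = b then 1 else 0) := by
      rintro ⟨y₁, y₂, u⟩
      cases u <;> simp
    have hi : ∀ b : Bool, Integrable (fun u : Bool => if u = b then (1 : ℝ) else 0)
        Measure.count := fun b => Integrable.of_finite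
    simp only [e]
    rw [integral_finsetSum]
    · have h : ∀ b : Bool, ∫ y : P.Y × P.Y × Bool, (1 / 2 * P.w (xor b x₂) y.1) *
          (P.w x₂ y.2.1 * if y.2.2 = b then 1 else 0)
          ∂(P.ν.prod (P.ν.prod Measure.count)) = 1 / 2 := fun b => by
        rw [integral_prod_mul (fun y => 1 / 2 * P.w (xor b x₂) y)
            (fun z : P.Y × Bool => P.w x₂ z.1 * if z.2 = b then (1 : ℝ) else 0),
          integral_prod_mul (P.w x₂) (fun u : Bool => if u = b then (1 : ℝ) else 0),
          integral_const_mul, P.integral_w, P.integral_w, integral_count]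
        simp
      simp only [h]
      norm_num
    · intro b _
      exact Integrable.mul_prod ((P.integrable_w _).const_mul _)
        (Integrable.mul_prod (P.integrable_w _) (hi b))
  π := fun y => (P.π y.1, P.π y.2.1, y.2.2)
  π_invol := fun y => by simp [P.π_invol y.1, P.π_invol y.2.1]
  π_preserving := P.π_preserving.prod (P.π_preserving.prod (MeasurePreserving.id _))
  w_symm x₂ y := by
    simp only [← P.w_symm, Bool.xor_not]

/-- The two children in the polarization tree: `false` is left (`P⁻`), `true` is right (`P⁺`). -/
def child (P : BMS) (b : Bool) : BMS := if b then P.plus else P.minus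

/-- The channels at level `n` of the polarization tree, from left to right; only the indices
`i < 2 ^ n` are meaningful. -/
def sub (W : BMS) : ℕ → ℕ → BMS
  | 0, _ => W
  | n + 1, i => (sub W n (i / 2)).child (i % 2 == 1)

/-- The tree in which every channel is quantized by `Q` as soon as it is formed, the root included,
and the children are formed from the quantized channel. -/
def quantSub (Q : BMS → BMS) (W : BMS) : ℕ → ℕ → BMS
  | 0, _ => Q W
  | n + 1, i => Q ((quantSub Q W n (i / 2)).child (i % 2 == 1))

/-- The binary erasure channel with erasure probability `e`; the output `none` is the erasure. -/
def bec (e : ℝ) (h0 : 0 ≤ e) (h1 : e ≤ 1) : BMS where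
  Y := Option Bool
  mY := ⊤
  ν := @Measure.count _ ⊤
  sigmaFinite := by
    let _ : MeasurableSpace (Option Bool) := ⊤
    infer_instance
  w x y := y.elim e fun c => if c = x then 1 - e else 0
  measurable_w x := measurable_from_top
  w_nonneg x y := by
    rcases y with _ | c
    · exact h0
    · simp only [Option.elim]
      split_ifs <;> linarith
  integral_w x := by
    let _ : MeasurableSpace (Option Bool) := ⊤
    rw [integral_count]
    cases x <;> simp [Fintype.sum_option]
  π := Option.map not
  π_invol := fun y => by cases y <;> simp
  π_preserving := by
    let _ : MeasurableSpace (Option Bool) := ⊤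
    have hinv : Function.Involutive (Option.map not) := fun y => by cases y <;> simp
    refine ⟨measurable_from_top, ?_⟩
    ext s hs
    rw [Measure.map_apply measurable_from_top hs, ← hinv.image_eq_preimage_symm,
      Measure.count_injective_image hinv.injective]
  w_symm x y := by
    rcases y with _ | c
    · rfl
    · cases x <;> cases c <;> rfl

/-! ### Mass representation of discrete channels -/

/-- The crossover probability carried by the output symbol `y`
(irrelevant if `y` has probability zero). -/
def chi (P : BMS) (y : P.Y) : ℝ :=
  min (P.w false y) (P.w true y) / (P.w false y + P.w true y)

theorem chi_mem (P : BMS) (y : P.Y) : 0 ≤ P.chi y ∧ P.chi y ≤ 1 / 2 := by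
  have h0 := P.w_nonneg false y
  have h1 := P.w_nonneg true y
  refine ⟨div_nonneg (le_min h0 h1) (add_nonneg h0 h1), ?_⟩
  refine div_le_of_le_mul₀ (add_nonneg h0 h1) (by norm_num) ?_
  have := min_le_left (P.w false y) (P.w true y)
  have := min_le_right (P.w false y) (P.w true y)
  linarith

/-- The probability, under uniform input, that the output has crossover probability `x`. -/
def chiMass (P : BMS) (x : ℝ) : ℝ :=
  ∫ y in P.chi ⁻¹' {x}, (P.w false y + P.w true y) / 2 ∂P.ν

theorem chiMass_nonneg (P : BMS) (x : ℝ) : 0 ≤ P.chiMass x :=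
  integral_nonneg fun y =>
    div_nonneg (add_nonneg (P.w_nonneg false y) (P.w_nonneg true y)) (by norm_num)

theorem measurable_chi (P : BMS) : Measurable P.chi :=
  ((P.measurable_w _).min (P.measurable_w _)).div ((P.measurable_w _).add (P.measurable_w _))

open Classical in
/-- The positions `x` carrying positive mass, for a finite output alphabet. -/
def positions (P : BMS) [Finite P.Y] : Finset ℝ :=
  (Set.finite_range P.chi).toFinset.filter fun x => 0 < P.chiMass x

/-- The list `(p₁, x₁), …, (p_m, x_m)`, `x₁ < ⋯ < x_m`, of the masses of a channel with finite
output alphabet: `p_i > 0` is the probability of the crossover probability `x_i ∈ [0, 1/2]`. -/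
def masses (P : BMS) [Finite P.Y] : List (ℝ × ℝ) :=
  (P.positions.sort (· ≤ ·)).map fun x => (P.chiMass x, x)

end BMS

/-- A list of masses `(p_i, x_i)` that describes a probability distribution on `[0, 1/2]`. -/
def IsMassList (l : List (ℝ × ℝ)) : Prop :=
  (∀ a ∈ l, 0 < a.1 ∧ 0 ≤ a.2 ∧ a.2 ≤ 1 / 2) ∧ (l.map Prod.fst).sum = 1

theorem BMS.isMassList_masses (P : BMS) [Finite P.Y] : IsMassList P.masses := by
  classical
  constructor
  · intro a ha
    simp only [BMS.masses, List.mem_map, Finset.mem_sort, BMS.positions, Finset.mem_filter,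
      Set.Finite.mem_toFinset, Set.mem_range] at ha
    obtain ⟨x, ⟨⟨y, rfl⟩, hx⟩, rfl⟩ := ha
    exact ⟨hx, P.chi_mem y⟩
  · have h1 : (P.masses.map Prod.fst).sum = ∑ x ∈ P.positions, P.chiMass x := by
      simp only [BMS.masses, List.map_map]
      rw [← Finset.sum_map_toList]
      exact ((Finset.sort_perm_toList P.positions (· ≤ ·)).map _).sum_eq
    have h2 : ∑ x ∈ P.positions, P.chiMass x =
        ∑ x ∈ (Set.finite_range P.chi).toFinset, P.chiMass x := by
      refine Finset.sum_subset (Finset.filter_subset _ _) fun x hx hx' => ?_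
      by_contra hne
      exact hx' (Finset.mem_filter.2 ⟨hx, lt_of_le_of_ne (P.chiMass_nonneg x) (Ne.symm hne)⟩)
    have hint : Integrable (fun y => (P.w false y + P.w true y) / 2) P.ν :=
      ((P.integrable_w _).add (P.integrable_w _)).div_const 2
    have h3 : ∑ x ∈ (Set.finite_range P.chi).toFinset, P.chiMass x =
        ∫ y in ⋃ x ∈ (Set.finite_range P.chi).toFinset, P.chi ⁻¹' {x},
          (P.w false y + P.w true y) / 2 ∂P.ν := by
      refine (integral_biUnion_finset _ (fun x _ => P.measurable_chi (measurableSet_singleton x))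
        ?_ fun x _ => hint.integrableOn).symm
      intro x _ x' _ hne
      exact Disjoint.preimage _ (by simpa using hne)
    have h4 : (⋃ x ∈ (Set.finite_range P.chi).toFinset, P.chi ⁻¹' {x}) = Set.univ := by
      ext y
      simp
    rw [h1, h2, h3, h4, setIntegral_univ, integral_div,
      integral_add (P.integrable_w _) (P.integrable_w _), P.integral_w, P.integral_w]
    norm_num

/-- The channel that picks the BSC with crossover probability `x_i` with probability `p_i` and
outputs `i` together with the output bit of that BSC. -/
def BMS.ofMasses (l : List (ℝ × ℝ)) (hl : IsMassList l) : BMS where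
  Y := Fin l.length × Bool
  ν := Measure.count
  w x y := (l.get y.1).1 * if y.2 = x then 1 - (l.get y.1).2 else (l.get y.1).2
  measurable_w x := measurable_of_finite _
  w_nonneg x y := by
    obtain ⟨h1, h2, h3⟩ := hl.1 _ (l.get_mem y.1)
    refine mul_nonneg h1.le ?_
    split_ifs <;> linarith
  integral_w x := by
    rw [integral_count, Fintype.sum_prod_type]
    have : ∀ i : Fin l.length, ∑ c : Bool, (l.get i).1 *
        (if c = x then 1 - (l.get i).2 else (l.get i).2) = (l.get i).1 := fun i => by
      cases x <;> simp <;> ring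
    simp only [this]
    rw [← hl.2, ← List.sum_ofFn]
    congr 1
    conv_rhs => rw [← List.ofFn_get l, List.map_ofFn]
    rfl
  π := fun y => (y.1, !y.2)
  π_invol := fun y => by simp
  π_preserving := by
    have hinv : Function.Involutive fun y : Fin l.length × Bool => (y.1, !y.2) :=
      fun y => by simp
    refine ⟨measurable_of_finite _, ?_⟩
    ext s hs
    rw [Measure.map_apply (measurable_of_finite _) hs, ← hinv.image_eq_preimage_symm,
      Measure.count_injective_image hinv.injective]
  w_symm x y := by
    cases x <;> cases h : y.2 <;> simp

/-! ### The greedy mass algorithms -/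

/-- The two greedy algorithms. -/
inductive MassAlgorithm
  | transportation
  | merging

/-- The centre of mass of two masses. -/
def massCentre (a b : ℝ × ℝ) : ℝ :=
  a.1 / (a.1 + b.1) * a.2 + b.1 / (a.1 + b.1) * b.2

/-- The price, measured by `f`, of joining the neighbouring masses `a = (p_i, x_i)` and
`b = (p_{i+1}, x_{i+1})`. -/
def MassAlgorithm.cost (A : MassAlgorithm) (f : ℝ → ℝ) (a b : ℝ × ℝ) : ℝ :=
  match A with
  | .transportation => a.1 * (f b.2 - f a.2)
  | .merging => a.1 * (f (massCentre a b) - f a.2) - b.1 * (f b.2 - f (massCentre a b))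

/-- The mass that replaces the neighbouring masses `a` and `b`. -/
def MassAlgorithm.join (A : MassAlgorithm) (a b : ℝ × ℝ) : ℝ × ℝ :=
  match A with
  | .transportation => (a.1 + b.1, b.2)
  | .merging => (a.1 + b.1, massCentre a b)

/-- The list of the costs of all pairs of neighbours. -/
def MassAlgorithm.costs (A : MassAlgorithm) (f : ℝ → ℝ) : List (ℝ × ℝ) → List ℝ
  | a :: b :: t => A.cost f a b :: A.costs f (b :: t)
  | _ => []

/-- Replace the masses number `j` and `j + 1` (counted from `0`) by their join. -/
def MassAlgorithm.joinAt (A : MassAlgorithm) : ℕ → List (ℝ × ℝ) → List (ℝ × ℝ)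
  | 0, a :: b :: t => A.join a b :: t
  | j + 1, a :: t => a :: A.joinAt j t
  | _, l => l

open Classical in
/-- One step: join the (first) pair of neighbours of least cost. -/
def MassAlgorithm.step (A : MassAlgorithm) (f : ℝ → ℝ) (l : List (ℝ × ℝ)) : List (ℝ × ℝ) :=
  match (List.range (A.costs f l).length).argmin fun j => (A.costs f l).getD j 0 with
  | some j => A.joinAt j l
  | none => l

/-- The greedy algorithm: steps are made until (at most) `k` masses are left. -/
def MassAlgorithm.run (A : MassAlgorithm) (f : ℝ → ℝ) (k : ℕ) (l : List (ℝ × ℝ)) :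
    List (ℝ × ℝ) :=
  (A.step f)^[l.length - k] l

theorem isMassList_joinAt (A : MassAlgorithm) (j : ℕ) (l : List (ℝ × ℝ))
    (h : ∀ a ∈ l, 0 < a.1 ∧ 0 ≤ a.2 ∧ a.2 ≤ 1 / 2) :
    (∀ a ∈ A.joinAt j l, 0 < a.1 ∧ 0 ≤ a.2 ∧ a.2 ≤ 1 / 2) ∧
      ((A.joinAt j l).map Prod.fst).sum = (l.map Prod.fst).sum := by
  fun_induction MassAlgorithm.joinAt A j l with
  | case1 a b t =>
    have ha := h a (by simp)
    have hb := h b (by simp)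
    have hs : 0 < a.1 + b.1 := add_pos ha.1 hb.1
    have hc : massCentre a b = (a.1 * a.2 + b.1 * b.2) / (a.1 + b.1) := by
      unfold massCentre
      ring
    refine ⟨fun c hc' => ?_, by cases A <;> simp [MassAlgorithm.join, add_assoc]⟩
    rcases List.mem_cons.1 hc' with rfl | hc'
    · cases A with
      | transportation => exact ⟨hs, hb.2⟩
      | merging =>
        refine ⟨hs, ?_⟩
        simp only [MassAlgorithm.join, hc]
        constructor
        · exact div_nonneg (add_nonneg (mul_nonneg ha.1.le ha.2.1)
            (mul_nonneg hb.1.le hb.2.1)) hs.le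
        · rw [div_le_iff₀ hs]
          nlinarith [mul_le_mul_of_nonneg_left ha.2.2 ha.1.le,
            mul_le_mul_of_nonneg_left hb.2.2 hb.1.le]
    · exact h c (by simp [hc'])
  | case2 j a t ih =>
    have ih' := ih fun c hc => h c (by simp [hc])
    refine ⟨fun c hc => ?_, by simp [ih'.2]⟩
    rcases List.mem_cons.1 hc with rfl | hc
    · exact h _ (by simp)
    · exact ih'.1 c hc
  | case3 => exact ⟨h, rfl⟩

theorem IsMassList.step {l : List (ℝ × ℝ)} (h : IsMassList l) (A : MassAlgorithm) (f : ℝ → ℝ) :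
    IsMassList (A.step f l) := by
  unfold MassAlgorithm.step
  split
  · rename_i j _
    have := isMassList_joinAt A j l h.1
    exact ⟨this.1, this.2.trans h.2⟩
  · exact h

theorem IsMassList.run {l : List (ℝ × ℝ)} (h : IsMassList l) (A : MassAlgorithm) (f : ℝ → ℝ)
    (k : ℕ) : IsMassList (A.run f k l) := by
  unfold MassAlgorithm.run
  induction l.length - k with
  | zero => exact h
  | succ n ih =>
    rw [Function.iterate_succ_apply']
    exact ih.step A f

/-! ### Quantization procedures -/

/-- `Q` assigns to each channel a channel with at most `k` output symbols. -/
def IsQuantizer (k : ℕ) (Q : BMS → BMS) : Prop :=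
  ∀ P, Finite (Q P).Y ∧ Nat.card (Q P).Y ≤ k

/-- `Q` is admissible: along the polarization tree of every channel, quantization never decreases
the Bhattacharyya parameters. -/
def Admissible (Q : BMS → BMS) : Prop :=
  ∀ (W : BMS) (n i : ℕ), i < 2 ^ n → (W.sub n i).Z ≤ (BMS.quantSub Q W n i).Z

/-- `Q` replaces every channel `P` with `Z(P) < δ` by the erasure channel `BEC(Z(P))`, and every
other channel with finite output alphabet by the output of the mass algorithm `A` (with cost
function `f`), run down to `⌊k/2⌋` masses.  As a mass is a BSC, which has two output symbols,
`⌊k/2⌋` masses amount to at most `k` output symbols. -/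
def IsMassBECScheme (A : MassAlgorithm) (f : ℝ → ℝ) (δ : ℝ) (k : ℕ) (Q : BMS → BMS) : Prop :=
  ∀ P : BMS,
    (P.Z < δ → Q P = BMS.bec P.Z P.Z_nonneg P.Z_le_one) ∧
    (δ ≤ P.Z → ∀ _ : Finite P.Y,
      Q P = BMS.ofMasses (A.run f (k / 2) P.masses) (P.isMassList_masses.run A f (k / 2)))

open Classical in
/-- `ρ = ρ(Q, W)`: the limit exists and equals `ρ`. -/
def IsGoodFraction (Q : BMS → BMS) (W : BMS) (ρ : ℝ) : Prop :=
  Tendsto (fun n : ℕ =>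
      (((Finset.range (2 ^ n)).filter fun i => 1 / 2 < (BMS.quantSub Q W n i).I).card : ℝ) / 2 ^ n)
    atTop (𝓝 ρ)

end

/-!
A functional `P ↦ ∫ φ(P(y|0), P(y|1)) dν` with `φ` concave and positively homogeneous can only
increase when output symbols are merged, and both tree steps respect this order; `Z` and `1 - I` are
of this form, and so is `1 - T`, where `T(P) = ½ ∫ |P(y|0) - P(y|1)| dν` is the total variation
distance.  Hence every quantizer that degrades finite channels and replaces `P` by `BEC(Z(P))` for
`Z(P) < δ` is admissible.

`T` does the work of the martingale in the usual polarization argument.  It satisfies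
`T(P⁻) = T(P)²` and `T(P⁻) + T(P⁺) ≤ 2 T(P)`, and quantization does not increase it.  So its level
averages in the quantized tree decrease, and the sum over all levels of the average of
`(T (1 - T))²` is at most `2`, whatever the channels are.  Since `T` near `0` or `1` forces `I`
to be close to `T`, this makes `ρ` the limit of the averages of `T`, and it yields a level `n`,
bounded in terms of `δ` and `ε` alone, at which the average of `I` is close to that of `T`.

Below an erasure channel, quantization changes neither `Z` nor `T`, and there
`T(P⁻) + T(P⁺) = 2 T(P)`.
A channel of the quantized tree that is not an erasure channel has `Z ≥ δ`; on such channels `T` is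
small unless it is away from `0` and `1`, so at level `n` nearly all of the average of `T` is
carried by erasure channels, and `ρ` is within `O(ε)` of the average of `T` at level `n`.

Up to level `n` the alphabets have a size that does not depend on `k`, so for large `k` the
algorithm does not merge anything and capacity is lost only where a branch first meets a channel
with `Z < δ`, by at most `δ` per branch.
-/

noncomputable section

/-! ### Averages of functions of the two likelihoods -/

/-- A measurable function of a pair of likelihoods that grows at most linearly on the quadrant
`[0, ∞)²`.  Its average over the output of any channel exists. -/
structure IsLinearGrowth (Φ : ℝ → ℝ → ℝ) : Prop where
  measurable : Measurable fun p : ℝ × ℝ => Φ p.1 p.2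
  bound : ∃ C, 0 ≤ C ∧ ∀ a b, 0 ≤ a → 0 ≤ b → |Φ a b| ≤ C * (a + b)

/-- The analogue of `IsLinearGrowth` for functions of two pairs of likelihoods. -/
structure IsBilinearGrowth (G : ℝ → ℝ → ℝ → ℝ → ℝ) : Prop where
  measurable : Measurable fun p : (ℝ × ℝ) × ℝ × ℝ => G p.1.1 p.1.2 p.2.1 p.2.2
  bound : ∃ C, ∀ a b c d, 0 ≤ a → 0 ≤ b → 0 ≤ c → 0 ≤ d →
    |G a b c d| ≤ C * ((a + b) * (c + d))

/-- The function whose average over two independent outputs of `P` is the average of `Φ` over the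
output of `P.minus`. -/
def minusKernel (Φ : ℝ → ℝ → ℝ) (a b c d : ℝ) : ℝ :=
  Φ (1 / 2 * (a * c + b * d)) (1 / 2 * (b * c + a * d))

/-- The function whose average over two independent outputs of `P` is the average of `Φ` over the
output of `P.plus`; the two terms are the two values of the output bit. -/
def plusKernel (Φ : ℝ → ℝ → ℝ) (a b c d : ℝ) : ℝ :=
  Φ (1 / 2 * (b * c)) (1 / 2 * (a * d)) + Φ (1 / 2 * (a * c)) (1 / 2 * (b * d))

namespace IsLinearGrowth

variable {Φ Ψ : ℝ → ℝ → ℝ}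

theorem comp_measurable (h : IsLinearGrowth Φ) {α : Type*} [MeasurableSpace α] {u v : α → ℝ}
    (hu : Measurable u) (hv : Measurable v) : Measurable fun x => Φ (u x) (v x) :=
  h.measurable.comp (hu.prodMk hv)

theorem of_nonneg_of_le (hm : Measurable fun p : ℝ × ℝ => Φ p.1 p.2)
    (h0 : ∀ a b, 0 ≤ a → 0 ≤ b → 0 ≤ Φ a b) (h1 : ∀ a b, 0 ≤ a → 0 ≤ b → Φ a b ≤ (a + b) / 2) :
    IsLinearGrowth Φ where
  measurable := hm
  bound := ⟨1 / 2, by norm_num, fun a b ha hb => by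
    rw [abs_of_nonneg (h0 a b ha hb)]
    linarith [h1 a b ha hb]⟩

theorem neg (h : IsLinearGrowth Φ) : IsLinearGrowth fun a b => -Φ a b where
  measurable := h.measurable.neg
  bound := by simpa only [abs_neg] using h.bound

theorem add (h : IsLinearGrowth Φ) (h' : IsLinearGrowth Ψ) :
    IsLinearGrowth fun a b => Φ a b + Ψ a b where
  measurable := h.measurable.add h'.measurable
  bound := by
    obtain ⟨C, hC0, hC⟩ := h.bound
    obtain ⟨D, hD0, hD⟩ := h'.bound
    refine ⟨C + D, add_nonneg hC0 hD0, fun a b ha hb => (abs_add_le _ _).trans ?_⟩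
    rw [add_mul]
    exact add_le_add (hC a b ha hb) (hD a b ha hb)

theorem const_mul (h : IsLinearGrowth Φ) (r : ℝ) : IsLinearGrowth fun a b => r * Φ a b where
  measurable := h.measurable.const_mul r
  bound := by
    obtain ⟨C, hC0, hC⟩ := h.bound
    refine ⟨|r| * C, by positivity, fun a b ha hb => ?_⟩
    rw [abs_mul, mul_assoc]
    exact mul_le_mul_of_nonneg_left (hC a b ha hb) (abs_nonneg r)

theorem mul (h : IsLinearGrowth Φ) (h' : IsLinearGrowth Ψ) :
    IsBilinearGrowth fun a b c d => Φ a b * Ψ c d where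
  measurable := (h.comp_measurable (by fun_prop) (by fun_prop)).mul
    (h'.comp_measurable (by fun_prop) (by fun_prop))
  bound := by
    obtain ⟨C, hC0, hC⟩ := h.bound
    obtain ⟨D, -, hD⟩ := h'.bound
    refine ⟨C * D, fun a b c d ha hb hc hd => ?_⟩
    rw [abs_mul, mul_mul_mul_comm]
    exact mul_le_mul (hC a b ha hb) (hD c d hc hd) (abs_nonneg _) (by positivity)

theorem minusKernel (h : IsLinearGrowth Φ) : IsBilinearGrowth (minusKernel Φ) where
  measurable := h.comp_measurable (by fun_prop) (by fun_prop)
  bound := by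
    obtain ⟨C, -, hC⟩ := h.bound
    refine ⟨C / 2, fun a b c d ha hb hc hd => (hC _ _ (by positivity) (by positivity)).trans_eq ?_⟩
    ring

theorem plusKernel (h : IsLinearGrowth Φ) : IsBilinearGrowth (plusKernel Φ) where
  measurable := (h.comp_measurable (by fun_prop) (by fun_prop)).add
    (h.comp_measurable (by fun_prop) (by fun_prop))
  bound := by
    obtain ⟨C, -, hC⟩ := h.bound
    refine ⟨C / 2, fun a b c d ha hb hc hd => (abs_add_le _ _).trans ((add_le_add
      (hC _ _ (by positivity) (by positivity)) (hC _ _ (by positivity) (by positivity))).trans_eq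
      ?_)⟩
    ring

end IsLinearGrowth

namespace IsBilinearGrowth

variable {G H : ℝ → ℝ → ℝ → ℝ → ℝ}

theorem add (h : IsBilinearGrowth G) (h' : IsBilinearGrowth H) :
    IsBilinearGrowth fun a b c d => G a b c d + H a b c d where
  measurable := h.measurable.add h'.measurable
  bound := by
    obtain ⟨C, hC⟩ := h.bound
    obtain ⟨D, hD⟩ := h'.bound
    refine ⟨C + D, fun a b c d ha hb hc hd => (abs_add_le _ _).trans ?_⟩
    rw [add_mul]
    exact add_le_add (hC a b c d ha hb hc hd) (hD a b c d ha hb hc hd)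

theorem neg (h : IsBilinearGrowth G) : IsBilinearGrowth fun a b c d => -G a b c d where
  measurable := h.measurable.neg
  bound := by simpa only [abs_neg] using h.bound

theorem sub (h : IsBilinearGrowth G) (h' : IsBilinearGrowth H) :
    IsBilinearGrowth fun a b c d => G a b c d - H a b c d := by
  simpa only [sub_eq_add_neg] using h.add h'.neg

end IsBilinearGrowth

theorem isLinearGrowth_half_add : IsLinearGrowth fun a b => (a + b) / 2 :=
  .of_nonneg_of_le (by fun_prop) (fun _ _ _ _ => by positivity) fun _ _ _ _ => le_rfl

theorem IsLinearGrowth.symm_mul_half_add {Φ : ℝ → ℝ → ℝ} (h : IsLinearGrowth Φ) :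
    IsBilinearGrowth fun a b c d => Φ a b * ((c + d) / 2) + (a + b) / 2 * Φ c d :=
  (h.mul isLinearGrowth_half_add).add (isLinearGrowth_half_add.mul h)

namespace BMS

/-- The integral of `Φ(P(y|0), P(y|1))` over the output alphabet. -/
def avg (P : BMS) (Φ : ℝ → ℝ → ℝ) : ℝ := ∫ y, Φ (P.w false y) (P.w true y) ∂P.ν

/-- The integral of `G(P(y|0), P(y|1), Q(z|0), Q(z|1))` over pairs of outputs of two channels. -/
def avg₂ (P Q : BMS) (G : ℝ → ℝ → ℝ → ℝ → ℝ) : ℝ :=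
  ∫ z : P.Y × Q.Y, G (P.w false z.1) (P.w true z.1) (Q.w false z.2) (Q.w true z.2) ∂P.ν.prod Q.ν

variable {Φ Ψ : ℝ → ℝ → ℝ} {G H : ℝ → ℝ → ℝ → ℝ → ℝ}

theorem integrable_avg (P : BMS) (h : IsLinearGrowth Φ) :
    Integrable (fun y => Φ (P.w false y) (P.w true y)) P.ν := by
  obtain ⟨C, -, hC⟩ := h.bound
  refine Integrable.mono' (((P.integrable_w false).add (P.integrable_w true)).const_mul C) ?_
    (Eventually.of_forall fun y => hC _ _ (P.w_nonneg _ _) (P.w_nonneg _ _))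
  exact (h.comp_measurable (P.measurable_w _) (P.measurable_w _)).aestronglyMeasurable

theorem integrable_avg₂ (P Q : BMS) (h : IsBilinearGrowth G) :
    Integrable (fun z : P.Y × Q.Y =>
      G (P.w false z.1) (P.w true z.1) (Q.w false z.2) (Q.w true z.2)) (P.ν.prod Q.ν) := by
  obtain ⟨C, hC⟩ := h.bound
  refine Integrable.mono' ((((P.integrable_w false).add (P.integrable_w true)).mul_prod
    ((Q.integrable_w false).add (Q.integrable_w true))).const_mul C) ?_
    (Eventually.of_forall fun z => hC _ _ _ _ (P.w_nonneg _ _) (P.w_nonneg _ _) (Q.w_nonneg _ _)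
      (Q.w_nonneg _ _))
  have hP (x : Bool) : Measurable fun z : P.Y × Q.Y => P.w x z.1 :=
    (P.measurable_w x).comp measurable_fst
  have hQ (x : Bool) : Measurable fun z : P.Y × Q.Y => Q.w x z.2 :=
    (Q.measurable_w x).comp measurable_snd
  exact (h.measurable.comp (((hP _).prodMk (hP _)).prodMk
    ((hQ _).prodMk (hQ _)))).aestronglyMeasurable

theorem avg_nonneg (P : BMS) (h : ∀ a b, 0 ≤ a → 0 ≤ b → 0 ≤ Φ a b) : 0 ≤ P.avg Φ :=
  integral_nonneg fun _ => h _ _ (P.w_nonneg _ _) (P.w_nonneg _ _)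

theorem avg_mono (P : BMS) (hΦ : IsLinearGrowth Φ) (hΨ : IsLinearGrowth Ψ)
    (h : ∀ a b, 0 ≤ a → 0 ≤ b → Φ a b ≤ Ψ a b) : P.avg Φ ≤ P.avg Ψ :=
  integral_mono (P.integrable_avg hΦ) (P.integrable_avg hΨ)
    fun _ => h _ _ (P.w_nonneg _ _) (P.w_nonneg _ _)

theorem avg_add (P : BMS) (hΦ : IsLinearGrowth Φ) (hΨ : IsLinearGrowth Ψ) :
    P.avg (fun a b => Φ a b + Ψ a b) = P.avg Φ + P.avg Ψ :=
  integral_add (P.integrable_avg hΦ) (P.integrable_avg hΨ)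

theorem avg_neg (P : BMS) (Φ : ℝ → ℝ → ℝ) : P.avg (fun a b => -Φ a b) = -P.avg Φ :=
  integral_neg _

theorem avg_const_mul (P : BMS) (r : ℝ) (Φ : ℝ → ℝ → ℝ) :
    P.avg (fun a b => r * Φ a b) = r * P.avg Φ :=
  integral_const_mul r _

theorem avg_half_add (P : BMS) : P.avg (fun a b => (a + b) / 2) = 1 := by
  unfold avg
  rw [integral_div, integral_add (P.integrable_w _) (P.integrable_w _), P.integral_w, P.integral_w]
  norm_num

theorem avg_swap (P : BMS) (Φ : ℝ → ℝ → ℝ) : P.avg (fun a b => Φ b a) = P.avg Φ := by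
  have h := P.π_preserving.integral_comp'
    (f := ⟨⟨P.π, P.π, P.π_invol, P.π_invol⟩, P.π_preserving.measurable, P.π_preserving.measurable⟩)
    (fun y => Φ (P.w false y) (P.w true y))
  refine Eq.trans (integral_congr_ae (Eventually.of_forall fun y => ?_)) h
  exact congrArg₂ Φ (P.w_symm false y) (P.w_symm true y)

theorem avg₂_congr (P Q : BMS)
    (h : ∀ a b c d, 0 ≤ a → 0 ≤ b → 0 ≤ c → 0 ≤ d → G a b c d = H a b c d) :
    P.avg₂ Q G = P.avg₂ Q H :=
  integral_congr_ae (Eventually.of_forall fun _ =>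
    h _ _ _ _ (P.w_nonneg _ _) (P.w_nonneg _ _) (Q.w_nonneg _ _) (Q.w_nonneg _ _))

theorem avg₂_mono (P Q : BMS) (hG : IsBilinearGrowth G) (hH : IsBilinearGrowth H)
    (h : ∀ a b c d, 0 ≤ a → 0 ≤ b → 0 ≤ c → 0 ≤ d → G a b c d ≤ H a b c d) :
    P.avg₂ Q G ≤ P.avg₂ Q H :=
  integral_mono (P.integrable_avg₂ Q hG) (P.integrable_avg₂ Q hH) fun _ =>
    h _ _ _ _ (P.w_nonneg _ _) (P.w_nonneg _ _) (Q.w_nonneg _ _) (Q.w_nonneg _ _)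

theorem avg₂_add (P Q : BMS) (hG : IsBilinearGrowth G) (hH : IsBilinearGrowth H) :
    P.avg₂ Q (fun a b c d => G a b c d + H a b c d) = P.avg₂ Q G + P.avg₂ Q H :=
  integral_add (P.integrable_avg₂ Q hG) (P.integrable_avg₂ Q hH)

theorem avg₂_mul (P Q : BMS) (Φ Ψ : ℝ → ℝ → ℝ) :
    P.avg₂ Q (fun a b c d => Φ a b * Ψ c d) = P.avg Φ * Q.avg Ψ :=
  integral_prod_mul (fun y => Φ (P.w false y) (P.w true y)) fun y => Ψ (Q.w false y) (Q.w true y)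

theorem avg₂_sub (P Q : BMS) (hG : IsBilinearGrowth G) (hH : IsBilinearGrowth H) :
    P.avg₂ Q (fun a b c d => G a b c d - H a b c d) = P.avg₂ Q G - P.avg₂ Q H :=
  integral_sub (P.integrable_avg₂ Q hG) (P.integrable_avg₂ Q hH)

theorem avg₂_symm_mul_half_add (P : BMS) (hΦ : IsLinearGrowth Φ) :
    P.avg₂ P (fun a b c d => Φ a b * ((c + d) / 2) + (a + b) / 2 * Φ c d) = 2 * P.avg Φ := by
  rw [P.avg₂_add P (hΦ.mul isLinearGrowth_half_add) (isLinearGrowth_half_add.mul hΦ),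
    avg₂_mul P P Φ fun c d => (c + d) / 2, avg₂_mul P P fun a b => (a + b) / 2, avg_half_add]
  ring

/-! ### The two transforms -/

theorem avg_minus (P : BMS) (Φ : ℝ → ℝ → ℝ) : P.minus.avg Φ = P.avg₂ P (minusKernel Φ) := by
  refine integral_congr_ae (Eventually.of_forall fun z => congrArg₂ Φ ?_ ?_) <;>
  · simp only [minus, Fintype.sum_bool, Bool.false_xor, Bool.true_xor, Bool.not_true,
      Bool.not_false]
    ring

theorem avg_plus (P : BMS) (h : IsLinearGrowth Φ) :
    P.plus.avg Φ = P.avg₂ P (plusKernel Φ) := by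
  have assoc : MeasurePreserving (MeasurableEquiv.prodAssoc : (P.Y × P.Y) × Bool ≃ᵐ _)
      ((P.ν.prod P.ν).prod Measure.count) (P.ν.prod (P.ν.prod Measure.count)) :=
    measurePreserving_prodAssoc _ _ _
  have int := (assoc.integrable_comp_emb (MeasurableEquiv.measurableEmbedding _)).2
    (P.plus.integrable_avg h)
  refine (assoc.integral_comp' _).symm.trans ((integral_prod _ int).trans ?_)
  refine integral_congr_ae (Eventually.of_forall fun z => ?_)
  simp only [integral_count, Fintype.sum_bool]
  simp [plus, plusKernel, MeasurableEquiv.prodAssoc, Function.comp, mul_assoc]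

end BMS

/-! ### Degradation -/

/-- A concave, positively homogeneous function of linear growth on the quadrant `[0, ∞)²`;
given homogeneity, concavity is superadditivity. -/
structure IsConcaveHomog (Φ : ℝ → ℝ → ℝ) : Prop extends IsLinearGrowth Φ where
  homog : ∀ r a b, 0 ≤ r → 0 ≤ a → 0 ≤ b → Φ (r * a) (r * b) = r * Φ a b
  superadd : ∀ a b a' b', 0 ≤ a → 0 ≤ b → 0 ≤ a' → 0 ≤ b' →
    Φ a b + Φ a' b' ≤ Φ (a + a') (b + b')

/-- A function of two pairs of likelihoods that is concave and homogeneous in either pair. -/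
structure IsBiconcaveHomog (G : ℝ → ℝ → ℝ → ℝ → ℝ) : Prop extends IsBilinearGrowth G where
  left : ∀ c d, 0 ≤ c → 0 ≤ d → IsConcaveHomog fun a b => G a b c d
  right : ∀ a b, 0 ≤ a → 0 ≤ b → IsConcaveHomog fun c d => G a b c d

namespace IsConcaveHomog

variable {Φ Ψ : ℝ → ℝ → ℝ}

theorem swap (h : IsConcaveHomog Φ) : IsConcaveHomog fun a b => Φ b a where
  measurable := h.comp_measurable measurable_snd measurable_fst
  bound := by
    obtain ⟨C, hC0, hC⟩ := h.bound
    exact ⟨C, hC0, fun a b ha hb => add_comm a b ▸ hC b a hb ha⟩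
  homog r a b hr ha hb := h.homog r b a hr hb ha
  superadd a b a' b' ha hb ha' hb' := h.superadd b a b' a' hb ha hb' ha'

theorem add (h : IsConcaveHomog Φ) (h' : IsConcaveHomog Ψ) :
    IsConcaveHomog fun a b => Φ a b + Ψ a b where
  toIsLinearGrowth := h.toIsLinearGrowth.add h'.toIsLinearGrowth
  homog r a b hr ha hb := by rw [h.homog r a b hr ha hb, h'.homog r a b hr ha hb, mul_add]
  superadd a b a' b' ha hb ha' hb' := by
    linarith [h.superadd a b a' b' ha hb ha' hb', h'.superadd a b a' b' ha hb ha' hb']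

theorem comp_linear (h : IsConcaveHomog Φ) {p q r s : ℝ} (hp : 0 ≤ p) (hq : 0 ≤ q) (hr : 0 ≤ r)
    (hs : 0 ≤ s) : IsConcaveHomog fun a b => Φ (p * a + q * b) (r * a + s * b) where
  measurable := h.comp_measurable (by fun_prop) (by fun_prop)
  bound := by
    obtain ⟨C, hC0, hC⟩ := h.bound
    refine ⟨C * (p + q + r + s), by positivity, fun a b ha hb =>
      (hC _ _ (by positivity) (by positivity)).trans ?_⟩
    rw [mul_assoc]
    refine mul_le_mul_of_nonneg_left ?_ hC0
    linarith [mul_nonneg hp hb, mul_nonneg hq ha, mul_nonneg hr hb, mul_nonneg hs ha]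
  homog t a b ht ha hb := by
    rw [← h.homog t _ _ ht (by positivity) (by positivity)]
    congr 1 <;> ring
  superadd a b a' b' ha hb ha' hb' := by
    refine (h.superadd _ _ _ _ (by positivity) (by positivity) (by positivity)
      (by positivity)).trans_eq ?_
    congr 1 <;> ring

theorem minusKernel (h : IsConcaveHomog Φ) : IsBiconcaveHomog (minusKernel Φ) where
  toIsBilinearGrowth := h.toIsLinearGrowth.minusKernel
  left c d hc hd := by
    unfold _root_.minusKernel
    convert h.comp_linear (p := c / 2) (q := d / 2) (r := d / 2) (s := c / 2) (by positivity)
      (by positivity) (by positivity) (by positivity) using 4 <;> ring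
  right a b ha hb := by
    unfold _root_.minusKernel
    convert h.comp_linear (p := a / 2) (q := b / 2) (r := b / 2) (s := a / 2) (by positivity)
      (by positivity) (by positivity) (by positivity) using 4 <;> ring

theorem plusKernel (h : IsConcaveHomog Φ) : IsBiconcaveHomog (plusKernel Φ) where
  toIsBilinearGrowth := h.toIsLinearGrowth.plusKernel
  left c d hc hd := by
    unfold _root_.plusKernel
    convert (h.comp_linear (p := 0) (q := c / 2) (r := d / 2) (s := 0) le_rfl (by positivity)
      (by positivity) le_rfl).add (h.comp_linear (p := c / 2) (q := 0) (r := 0) (s := d / 2)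
      (by positivity) le_rfl le_rfl (by positivity)) using 5 <;> ring
  right a b ha hb := by
    unfold _root_.plusKernel
    convert (h.comp_linear (p := b / 2) (q := 0) (r := 0) (s := a / 2) (by positivity) le_rfl
      le_rfl (by positivity)).add (h.comp_linear (p := a / 2) (q := 0) (r := 0) (s := b / 2)
      (by positivity) le_rfl le_rfl (by positivity)) using 5 <;> ring

end IsConcaveHomog

namespace BMS

/-- `Q` is a degraded version of `P`, tested on all concave homogeneous functions of the
likelihoods (by Blackwell's theorem this is the existence of a degrading kernel). -/
def DegradesTo (P Q : BMS) : Prop := ∀ Φ, IsConcaveHomog Φ → P.avg Φ ≤ Q.avg Φ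

namespace DegradesTo

variable {P Q R S : BMS}

theorem refl (P : BMS) : P.DegradesTo P := fun _ _ => le_rfl

theorem trans (h : P.DegradesTo Q) (h' : Q.DegradesTo R) : P.DegradesTo R :=
  fun Φ hΦ => (h Φ hΦ).trans (h' Φ hΦ)

theorem avg₂_le (h : P.DegradesTo Q) (h' : R.DegradesTo S) {G : ℝ → ℝ → ℝ → ℝ → ℝ}
    (hG : IsBiconcaveHomog G) : P.avg₂ R G ≤ Q.avg₂ S G := by
  have int (P Q : BMS) := P.integrable_avg₂ Q hG.toIsBilinearGrowth
  calc P.avg₂ R G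
      = ∫ x, R.avg (G (P.w false x) (P.w true x)) ∂P.ν := integral_prod _ (int P R)
    _ ≤ ∫ x, S.avg (G (P.w false x) (P.w true x)) ∂P.ν :=
        integral_mono (int P R).integral_prod_left (int P S).integral_prod_left fun x =>
          h' _ (hG.right _ _ (P.w_nonneg _ _) (P.w_nonneg _ _))
    _ = P.avg₂ S G := (integral_prod _ (int P S)).symm
    _ = ∫ y, P.avg (fun a b => G a b (S.w false y) (S.w true y)) ∂S.ν :=
        integral_prod_symm _ (int P S)
    _ ≤ ∫ y, Q.avg (fun a b => G a b (S.w false y) (S.w true y)) ∂S.ν :=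
        integral_mono (int P S).integral_prod_right (int Q S).integral_prod_right fun y =>
          h _ (hG.left _ _ (S.w_nonneg _ _) (S.w_nonneg _ _))
    _ = Q.avg₂ S G := (integral_prod_symm _ (int Q S)).symm

theorem minus (h : P.DegradesTo Q) : P.minus.DegradesTo Q.minus := fun Φ hΦ => by
  simpa only [avg_minus] using h.avg₂_le h hΦ.minusKernel

theorem plus (h : P.DegradesTo Q) : P.plus.DegradesTo Q.plus := fun Φ hΦ => by
  simpa only [avg_plus _ hΦ.toIsLinearGrowth] using h.avg₂_le h hΦ.plusKernel

theorem child (h : P.DegradesTo Q) (b : Bool) : (P.child b).DegradesTo (Q.child b) := by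
  cases b
  · exact h.minus
  · exact h.plus

end DegradesTo

end BMS

/-! ### Bhattacharyya parameter and total variation distance -/

section TwoNumbers

variable {a b c d : ℝ}

theorem abs_sub_le_add_of_nonneg (ha : 0 ≤ a) (hb : 0 ≤ b) : |a - b| ≤ a + b :=
  abs_sub_le_iff.2 ⟨by linarith, by linarith⟩

theorem abs_add_add_abs_sub_eq_two_mul_max (a b : ℝ) :
    |a + b| + |a - b| = 2 * max |a| |b| := by
  rcases abs_cases a with ⟨ha, _⟩ | ⟨ha, _⟩ <;> rcases abs_cases b with ⟨hb, _⟩ | ⟨hb, _⟩ <;>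
  rcases abs_cases (a + b) with ⟨hs, _⟩ | ⟨hs, _⟩ <;>
  rcases abs_cases (a - b) with ⟨hd, _⟩ | ⟨hd, _⟩ <;>
  rcases max_cases |a| |b| with ⟨hm, _⟩ | ⟨hm, _⟩ <;> linarith

theorem sqrt_mul_le_half_add (ha : 0 ≤ a) (hb : 0 ≤ b) : √(a * b) ≤ (a + b) / 2 :=
  Real.sqrt_le_iff.2 ⟨by positivity, by nlinarith [sq_nonneg (a - b)]⟩

theorem min_eq_half_add_sub_half_abs_sub (a b : ℝ) : min a b = (a + b) / 2 - |a - b| / 2 := by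
  rcases le_total a b with h | h
  · rw [min_eq_left h, abs_of_nonpos (sub_nonpos.2 h)]
    ring
  · rw [min_eq_right h, abs_of_nonneg (sub_nonneg.2 h)]
    ring

theorem min_le_sqrt_mul (ha : 0 ≤ a) (hb : 0 ≤ b) : min a b ≤ √(a * b) :=
  Real.le_sqrt_of_sq_le <| sq (min a b) ▸
    mul_le_mul (min_le_left a b) (min_le_right a b) (le_min ha hb) ha

theorem sqrt_mul_add_sqrt_mul_le (ha : 0 ≤ a) (hb : 0 ≤ b) (hc : 0 ≤ c) (hd : 0 ≤ d) :
    √(a * b) + √(c * d) ≤ √((a + c) * (b + d)) := by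
  refine Real.le_sqrt_of_sq_le ?_
  have cross : 2 * (√(a * b) * √(c * d)) ≤ a * d + c * b := by
    rw [← Real.sqrt_mul (mul_nonneg ha hb), mul_mul_mul_comm, mul_comm b d, ← mul_mul_mul_comm]
    linarith [sqrt_mul_le_half_add (mul_nonneg ha hd) (mul_nonneg hc hb)]
  nlinarith [Real.sq_sqrt (mul_nonneg ha hb), Real.sq_sqrt (mul_nonneg hc hd)]

theorem minusKernel_sqrt_le (ha : 0 ≤ a) (hb : 0 ≤ b) (hc : 0 ≤ c) (hd : 0 ≤ d) :
    minusKernel (fun a b => √(a * b)) a b c d ≤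
      √(a * b) * ((c + d) / 2) + (a + b) / 2 * √(c * d) - √(a * b) * √(c * d) := by
  have hs := sub_nonneg.2 (sqrt_mul_le_half_add ha hb)
  have ht := sub_nonneg.2 (sqrt_mul_le_half_add hc hd)
  have hs2 := Real.sq_sqrt (mul_nonneg ha hb)
  have ht2 := Real.sq_sqrt (mul_nonneg hc hd)
  have hs0 := Real.sqrt_nonneg (a * b)
  have ht0 := Real.sqrt_nonneg (c * d)
  refine Real.sqrt_le_iff.2 ⟨by nlinarith [mul_nonneg hs0 ht, mul_nonneg ht0 hs], ?_⟩
  generalize √(a * b) = s at *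
  generalize √(c * d) = t at *
  calc 1 / 2 * (a * c + b * d) * (1 / 2 * (b * c + a * d))
      = s ^ 2 * ((c + d) / 2) ^ 2 + t ^ 2 * ((a + b) / 2) ^ 2 - s ^ 2 * t ^ 2 := by
        rw [hs2, ht2]; ring
    _ ≤ s ^ 2 * ((c + d) / 2) ^ 2 + t ^ 2 * ((a + b) / 2) ^ 2 - s ^ 2 * t ^ 2 +
        2 * (s * t) * (((a + b) / 2 - s) * ((c + d) / 2 - t)) :=
        le_add_of_nonneg_right (by positivity)
    _ = (s * ((c + d) / 2) + (a + b) / 2 * t - s * t) ^ 2 := by ring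

theorem plusKernel_abs_sub_le (ha : 0 ≤ a) (hb : 0 ≤ b) (hc : 0 ≤ c) (hd : 0 ≤ d) :
    plusKernel (fun a b => |a - b| / 2) a b c d ≤
      |a - b| / 2 * ((c + d) / 2) + (a + b) / 2 * (|c - d| / 2) -
        |a - b| / 2 * (|c - d| / 2) := by
  have hX : |(a - b) * (c + d)| = |a - b| * (c + d) := by
    rw [abs_mul, abs_of_nonneg (add_nonneg hc hd)]
  have hY : |(a + b) * (c - d)| = (a + b) * |c - d| := by
    rw [abs_mul, abs_of_nonneg (add_nonneg ha hb)]
  have hl : plusKernel (fun a b => |a - b| / 2) a b c d =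
      max (|a - b| * (c + d)) ((a + b) * |c - d|) / 4 := by
    have h := abs_add_add_abs_sub_eq_two_mul_max ((a - b) * (c + d)) ((a + b) * (c - d))
    rw [hX, hY, show (a - b) * (c + d) + (a + b) * (c - d) = 2 * (a * c - b * d) by ring,
      show (a - b) * (c + d) - (a + b) * (c - d) = -(2 * (b * c - a * d)) by ring, abs_neg,
      abs_mul, abs_mul, abs_two] at h
    simp only [plusKernel, ← mul_sub, abs_mul, abs_of_pos (one_half_pos (α := ℝ))]
    linarith
  have hab := mul_nonneg (sub_nonneg.2 (abs_sub_le_add_of_nonneg ha hb)) (abs_nonneg (c - d))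
  have hcd := mul_nonneg (abs_nonneg (a - b)) (sub_nonneg.2 (abs_sub_le_add_of_nonneg hc hd))
  rw [hl]
  rcases max_cases (|a - b| * (c + d)) ((a + b) * |c - d|) with ⟨h, _⟩ | ⟨h, _⟩ <;>
  · rw [h]
    linarith

end TwoNumbers

theorem isConcaveHomog_sqrt : IsConcaveHomog fun a b => √(a * b) where
  toIsLinearGrowth := .of_nonneg_of_le (by fun_prop) (fun _ _ _ _ => Real.sqrt_nonneg _)
    fun _ _ => sqrt_mul_le_half_add
  homog r a b hr _ _ := by
    rw [mul_mul_mul_comm, Real.sqrt_mul (mul_self_nonneg r), Real.sqrt_mul_self hr]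
  superadd _ _ _ _ := sqrt_mul_add_sqrt_mul_le

theorem isLinearGrowth_abs_sub : IsLinearGrowth fun a b => |a - b| / 2 :=
  .of_nonneg_of_le (by fun_prop) (fun _ _ _ _ => by positivity) fun _ _ ha hb =>
    div_le_div_of_nonneg_right (abs_sub_le_add_of_nonneg ha hb) two_pos.le

theorem isConcaveHomog_neg_abs_sub : IsConcaveHomog fun a b => -(|a - b| / 2) where
  toIsLinearGrowth := isLinearGrowth_abs_sub.neg
  homog r a b hr _ _ := by
    rw [← mul_sub, abs_mul, abs_of_nonneg hr]
    ring
  superadd a b a' b' _ _ _ _ := by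
    have := abs_add_le (a - b) (a' - b')
    rw [add_sub_add_comm]
    linarith

namespace BMS

/-- The total variation distance between the two output distributions. -/
def T (P : BMS) : ℝ := P.avg fun a b => |a - b| / 2

theorem Z_eq_avg (P : BMS) : P.Z = P.avg fun a b => √(a * b) := rfl

theorem DegradesTo.Z_le {P Q : BMS} (h : P.DegradesTo Q) : P.Z ≤ Q.Z := h _ isConcaveHomog_sqrt

theorem DegradesTo.T_le {P Q : BMS} (h : P.DegradesTo Q) : Q.T ≤ P.T := by
  simpa only [T, avg_neg, neg_le_neg_iff] using h _ isConcaveHomog_neg_abs_sub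

theorem T_nonneg (P : BMS) : 0 ≤ P.T := P.avg_nonneg fun _ _ _ _ => by positivity

theorem T_le_one (P : BMS) : P.T ≤ 1 := by
  rw [← P.avg_half_add]
  exact P.avg_mono isLinearGrowth_abs_sub isLinearGrowth_half_add fun a b ha hb =>
    div_le_div_of_nonneg_right (abs_sub_le_add_of_nonneg ha hb) two_pos.le

theorem one_le_T_add_Z (P : BMS) : 1 ≤ P.T + P.Z := by
  rw [Z_eq_avg, T, ← avg_add P isLinearGrowth_abs_sub isConcaveHomog_sqrt.toIsLinearGrowth,
    ← P.avg_half_add]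
  refine P.avg_mono isLinearGrowth_half_add
    (isLinearGrowth_abs_sub.add isConcaveHomog_sqrt.toIsLinearGrowth) fun a b ha hb => ?_
  linarith [min_le_sqrt_mul ha hb, min_eq_half_add_sub_half_abs_sub a b]

theorem sq_Z_add_sq_T_le_one (P : BMS) : P.Z ^ 2 + P.T ^ 2 ≤ 1 := by
  have hZ := isConcaveHomog_sqrt.toIsLinearGrowth.const_mul P.Z
  have hT := isLinearGrowth_abs_sub.const_mul P.T
  -- `√(ab)`, `|a - b| / 2` and `(a + b) / 2` are the sides of a right triangle.
  have pointwise (a b : ℝ) (ha : 0 ≤ a) (hb : 0 ≤ b) : P.Z * √(a * b) + P.T * (|a - b| / 2) ≤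
      (P.Z ^ 2 + P.T ^ 2 + 1) / 2 * ((a + b) / 2) := by
    have pythagoras : √(a * b) ^ 2 + (|a - b| / 2) ^ 2 = ((a + b) / 2) ^ 2 := by
      rw [Real.sq_sqrt (mul_nonneg ha hb), div_pow, sq_abs]
      ring
    have hs : 0 ≤ (a + b) / 2 := by positivity
    generalize √(a * b) = p at *
    generalize |a - b| / 2 = q at *
    generalize (a + b) / 2 = s at *
    rcases hs.eq_or_lt with rfl | hs
    · obtain ⟨rfl, rfl⟩ : p = 0 ∧ q = 0 := ⟨by nlinarith, by nlinarith⟩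
      simp
    · refine le_of_mul_le_mul_left ?_ hs
      nlinarith [sq_nonneg (p - P.Z * s), sq_nonneg (q - P.T * s)]
  have := P.avg_mono (hZ.add hT) (isLinearGrowth_half_add.const_mul _) pointwise
  rw [P.avg_add hZ hT, avg_const_mul, avg_const_mul, avg_const_mul, avg_half_add, ← Z_eq_avg,
    ← T] at this
  linarith

theorem avg₂_inclusion (P : BMS) {Φ : ℝ → ℝ → ℝ} (hΦ : IsLinearGrowth Φ) :
    P.avg₂ P (fun a b c d => Φ a b * ((c + d) / 2) + (a + b) / 2 * Φ c d - Φ a b * Φ c d) =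
      2 * P.avg Φ - P.avg Φ ^ 2 := by
  rw [← P.avg₂_symm_mul_half_add hΦ, sq, ← avg₂_mul]
  exact P.avg₂_sub P hΦ.symm_mul_half_add (hΦ.mul hΦ)

theorem T_minus (P : BMS) : P.minus.T = P.T ^ 2 := by
  rw [T, avg_minus, sq, T, ← avg₂_mul]
  refine avg₂_congr P P fun a b c d _ _ _ _ => ?_
  rw [minusKernel, ← mul_sub, show a * c + b * d - (b * c + a * d) = (a - b) * (c - d) by ring,
    abs_mul, abs_mul, abs_of_pos one_half_pos]
  ring

theorem Z_plus (P : BMS) : P.plus.Z = P.Z ^ 2 := by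
  rw [Z_eq_avg, avg_plus P isConcaveHomog_sqrt.toIsLinearGrowth, sq, Z_eq_avg, ← avg₂_mul]
  refine avg₂_congr P P fun a b c d ha hb hc hd => ?_
  rw [plusKernel, isConcaveHomog_sqrt.homog _ _ _ one_half_pos.le (by positivity) (by positivity),
    isConcaveHomog_sqrt.homog _ _ _ one_half_pos.le (by positivity) (by positivity),
    ← Real.sqrt_mul (mul_nonneg ha hb), show b * c * (a * d) = a * b * (c * d) by ring,
    show a * c * (b * d) = a * b * (c * d) by ring]
  ring

theorem Z_minus_le (P : BMS) : P.minus.Z ≤ 2 * P.Z - P.Z ^ 2 := by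
  have h := isConcaveHomog_sqrt.toIsLinearGrowth
  rw [Z_eq_avg, Z_eq_avg, ← P.avg₂_inclusion h, avg_minus]
  exact avg₂_mono P P h.minusKernel (h.symm_mul_half_add.sub (h.mul h))
    fun a b c d => minusKernel_sqrt_le

theorem T_plus_le (P : BMS) : P.plus.T ≤ 2 * P.T - P.T ^ 2 := by
  have h := isLinearGrowth_abs_sub
  rw [T, T, ← P.avg₂_inclusion h, avg_plus P h]
  exact avg₂_mono P P h.plusKernel (h.symm_mul_half_add.sub (h.mul h))
    fun a b c d => plusKernel_abs_sub_le

theorem T_minus_add_T_plus_le (P : BMS) : P.minus.T + P.plus.T ≤ 2 * P.T := by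
  linarith [P.T_minus, P.T_plus_le]

end BMS

/-! ### The symmetric capacity -/

theorem binEntropy_le_two_mul_sqrt {p : ℝ} (h0 : 0 ≤ p) (h1 : p ≤ 1) :
    Real.binEntropy p ≤ 2 * √(p * (1 - p)) := by
  rcases h0.eq_or_lt with rfl | h0
  · simp
  rcases h1.eq_or_lt with rfl | h1
  · simp
  have h1 : 0 < 1 - p := sub_pos.2 h1
  have hu := Real.sqrt_pos.2 h0
  have hv := Real.sqrt_pos.2 h1
  have jensen := strictConcaveOn_log_Ioi.concaveOn.2 (inv_pos.2 hu) (inv_pos.2 hv) h0.le h1.le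
    (by ring)
  have entropy : Real.binEntropy p =
      2 * (p * Real.log (√p)⁻¹ + (1 - p) * Real.log (√(1 - p))⁻¹) := by
    rw [Real.binEntropy, Real.log_inv, Real.log_inv, Real.log_inv, Real.log_inv,
      Real.log_sqrt h0.le, Real.log_sqrt h1.le]
    ring
  have mean : p * (√p)⁻¹ + (1 - p) * (√(1 - p))⁻¹ = √p + √(1 - p) := by
    rw [← div_eq_mul_inv, ← div_eq_mul_inv, Real.div_sqrt, Real.div_sqrt]
  simp only [smul_eq_mul, mean] at jensen
  calc Real.binEntropy p ≤ 2 * Real.log (√p + √(1 - p)) := by linarith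
    _ = Real.log ((√p + √(1 - p)) ^ 2) := by rw [Real.log_pow, Nat.cast_two]
    _ ≤ (√p + √(1 - p)) ^ 2 - 1 := Real.log_le_sub_one_of_pos (by positivity)
    _ = 2 * √(p * (1 - p)) := by
      rw [Real.sqrt_mul h0.le, add_sq, Real.sq_sqrt h0.le, Real.sq_sqrt h1.le]
      ring

theorem mul_log_two_le_binEntropy {p : ℝ} (h0 : 0 ≤ p) (h1 : p ≤ 1) :
    (1 - |1 - 2 * p|) * Real.log 2 ≤ Real.binEntropy p := by
  have chord (q : ℝ) (hq0 : 0 ≤ q) (hq1 : q ≤ 1 / 2) :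
      2 * q * Real.log 2 ≤ Real.binEntropy q := by
    have h := Real.strictConcave_binEntropy.concaveOn.2 (x := 0) (y := 2⁻¹) (by simp)
      (by norm_num) (show 0 ≤ 1 - 2 * q by linarith) (show 0 ≤ 2 * q by linarith) (by ring)
    simpa [show 2 * q * 2⁻¹ = q by ring] using h
  rcases le_total p (1 / 2) with h | h
  · rw [abs_of_nonneg (by linarith)]
    linarith [chord p h0 h]
  · rw [abs_of_nonpos (by linarith), ← Real.binEntropy_one_sub]
    linarith [chord (1 - p) (by linarith) (by linarith)]

theorem exists_eq_mul_one_sub_and_eq_mul {a b : ℝ} (ha : 0 ≤ a) (hb : 0 ≤ b) :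
    ∃ s x : ℝ, 0 ≤ s ∧ x ∈ Icc (0 : ℝ) 1 ∧ a = s * (1 - x) ∧ b = s * x := by
  rcases (add_nonneg ha hb).eq_or_lt with h | h
  · exact ⟨0, 0, le_rfl, by simp, by linarith, by linarith⟩
  · refine ⟨a + b, b / (a + b), h.le, ⟨by positivity, (div_le_one h).2 (by linarith)⟩, ?_, ?_⟩
    · rw [mul_sub, mul_div_cancel₀ _ h.ne']
      ring
    · rw [mul_div_cancel₀ _ h.ne']

theorem superadd_of_concaveOn {Φ : ℝ → ℝ → ℝ}
    (homog : ∀ r a b, 0 ≤ r → 0 ≤ a → 0 ≤ b → Φ (r * a) (r * b) = r * Φ a b)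
    (concave : ConcaveOn ℝ (Icc 0 1) fun x => Φ (1 - x) x) {a b a' b' : ℝ} (ha : 0 ≤ a)
    (hb : 0 ≤ b) (ha' : 0 ≤ a') (hb' : 0 ≤ b') : Φ a b + Φ a' b' ≤ Φ (a + a') (b + b') := by
  obtain ⟨s, x, hs, hx, rfl, rfl⟩ := exists_eq_mul_one_sub_and_eq_mul ha hb
  obtain ⟨t, y, ht, hy, rfl, rfl⟩ := exists_eq_mul_one_sub_and_eq_mul ha' hb'
  have simplex (r z : ℝ) (hr : 0 ≤ r) (hz : z ∈ Icc (0 : ℝ) 1) :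
      Φ (r * (1 - z)) (r * z) = r * Φ (1 - z) z := homog r _ _ hr (sub_nonneg.2 hz.2) hz.1
  rcases (add_nonneg hs ht).eq_or_lt with h | h
  · obtain ⟨rfl, rfl⟩ : s = 0 ∧ t = 0 := ⟨by linarith, by linarith⟩
    rw [simplex 0 x le_rfl hx, simplex 0 y le_rfl hy]
    simpa using (homog 0 0 0 le_rfl le_rfl le_rfl).ge
  have hw : s / (s + t) + t / (s + t) = 1 := by rw [← add_div, div_self h.ne']
  set z := s / (s + t) * x + t / (s + t) * y with hz
  have hsum : s * x + t * y = (s + t) * z := by rw [hz]; field_simp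
  have hz' : z ∈ Icc (0 : ℝ) 1 := convex_Icc 0 1 hx hy (by positivity) (by positivity) hw
  have hc := concave.2 hx hy (by positivity) (by positivity) hw
  rw [show s * (1 - x) + t * (1 - y) = (s + t) * (1 - z) by linarith, hsum,
    simplex s x hs hx, simplex t y ht hy, simplex (s + t) z h.le hz']
  calc s * Φ (1 - x) x + t * Φ (1 - y) y
      = (s + t) * (s / (s + t) * Φ (1 - x) x + t / (s + t) * Φ (1 - y) y) := by field_simp
    _ ≤ (s + t) * Φ (1 - z) z := mul_le_mul_of_nonneg_left hc h.le

/-- The integrand of the symmetric capacity, as a function of the two likelihoods. -/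
def capacityDensity (a b : ℝ) : ℝ :=
  1 / 2 * a * Real.logb 2 (a / (1 / 2 * a + 1 / 2 * b)) +
    1 / 2 * b * Real.logb 2 (b / (1 / 2 * a + 1 / 2 * b))

theorem capacityDensity_mul (r a b : ℝ) :
    capacityDensity (r * a) (r * b) = r * capacityDensity a b := by
  rcases eq_or_ne r 0 with rfl | hr
  · simp [capacityDensity]
  · unfold capacityDensity
    rw [show 1 / 2 * (r * a) + 1 / 2 * (r * b) = r * (1 / 2 * a + 1 / 2 * b) by ring,
      mul_div_mul_left _ _ hr, mul_div_mul_left _ _ hr]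
    ring

theorem capacityDensity_eq_log {a b : ℝ} (ha : 0 ≤ a) (hb : 0 ≤ b) :
    capacityDensity a b = (a * Real.log a + b * Real.log b - (a + b) * Real.log (a + b) +
      (a + b) * Real.log 2) / (2 * Real.log 2) := by
  have term (c s : ℝ) (hc : 0 ≤ c) (hs : c ≤ s) : 1 / 2 * c * Real.logb 2 (c / (s / 2)) =
      (c * Real.log c - c * Real.log s + c * Real.log 2) / (2 * Real.log 2) := by
    rcases hc.eq_or_lt with rfl | hc
    · simp
    · have hs0 : 0 < s := hc.trans_le hs
      rw [Real.logb, Real.log_div hc.ne' (by positivity), Real.log_div hs0.ne' two_ne_zero]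
      field_simp
      ring
  unfold capacityDensity
  rw [show 1 / 2 * a + 1 / 2 * b = (a + b) / 2 by ring, term a (a + b) ha (by linarith),
    term b (a + b) hb (by linarith)]
  ring

theorem capacityDensity_simplex {x : ℝ} (hx : x ∈ Icc (0 : ℝ) 1) :
    capacityDensity (1 - x) x = 1 / 2 - Real.binEntropy x / (2 * Real.log 2) := by
  have hl := (Real.log_pos one_lt_two).ne'
  rw [capacityDensity_eq_log (sub_nonneg.2 hx.2) hx.1, Real.binEntropy, Real.log_inv,
    Real.log_inv, sub_add_cancel, Real.log_one]
  field_simp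
  ring

theorem capacityDensity_nonneg {a b : ℝ} (ha : 0 ≤ a) (hb : 0 ≤ b) : 0 ≤ capacityDensity a b := by
  obtain ⟨s, x, hs, hx, rfl, rfl⟩ := exists_eq_mul_one_sub_and_eq_mul ha hb
  rw [capacityDensity_mul, capacityDensity_simplex hx]
  refine mul_nonneg hs (sub_nonneg.2 ((div_le_iff₀ (by positivity)).2 ?_))
  linarith [Real.binEntropy_le_log_two (p := x)]

theorem capacityDensity_le_half_abs_sub {a b : ℝ} (ha : 0 ≤ a) (hb : 0 ≤ b) :
    capacityDensity a b ≤ |a - b| / 2 := by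
  obtain ⟨s, x, hs, hx, rfl, rfl⟩ := exists_eq_mul_one_sub_and_eq_mul ha hb
  have h := (le_div_iff₀ (Real.log_pos one_lt_two)).2 (mul_log_two_le_binEntropy hx.1 hx.2)
  rw [capacityDensity_mul, capacityDensity_simplex hx, ← mul_sub, abs_mul, abs_of_nonneg hs,
    mul_div_assoc, show 1 - x - x = 1 - 2 * x by ring, mul_comm 2 (Real.log 2), ← div_div]
  exact mul_le_mul_of_nonneg_left (by linarith) hs

theorem half_add_sub_le_capacityDensity {a b : ℝ} (ha : 0 ≤ a) (hb : 0 ≤ b) :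
    (a + b) / 2 - 2 * √(a * b) ≤ capacityDensity a b := by
  obtain ⟨s, x, hs, hx, rfl, rfl⟩ := exists_eq_mul_one_sub_and_eq_mul ha hb
  have hl : (1 : ℝ) / 2 ≤ Real.log 2 := by linarith [Real.log_two_gt_d9]
  have h : Real.binEntropy x / (2 * Real.log 2) ≤ 2 * √((1 - x) * x) := by
    refine (div_le_iff₀ (by positivity)).2 ?_
    rw [mul_comm (1 - x)]
    nlinarith [binEntropy_le_two_mul_sqrt hx.1 hx.2, Real.sqrt_nonneg (x * (1 - x))]
  rw [capacityDensity_mul, capacityDensity_simplex hx, mul_mul_mul_comm,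
    Real.sqrt_mul (mul_self_nonneg s), Real.sqrt_mul_self hs]
  calc _ = s * (1 / 2 - 2 * √((1 - x) * x)) := by ring
    _ ≤ _ := mul_le_mul_of_nonneg_left (by linarith) hs

theorem isLinearGrowth_capacityDensity : IsLinearGrowth capacityDensity :=
  .of_nonneg_of_le (by unfold capacityDensity Real.logb; fun_prop)
    (fun _ _ => capacityDensity_nonneg) fun _ _ ha hb =>
      (capacityDensity_le_half_abs_sub ha hb).trans
        (div_le_div_of_nonneg_right (abs_sub_le_add_of_nonneg ha hb) two_pos.le)

theorem concaveOn_neg_capacityDensity_simplex :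
    ConcaveOn ℝ (Icc 0 1) fun x => -capacityDensity (1 - x) x := by
  have h := (Real.strictConcave_binEntropy.concaveOn.smul
    (show 0 ≤ (2 * Real.log 2)⁻¹ by positivity)).add_const (-(1 / 2))
  refine h.congr fun x hx => ?_
  rw [capacityDensity_simplex hx, div_eq_inv_mul, Pi.add_apply, smul_eq_mul]
  ring

theorem isConcaveHomog_neg_capacityDensity : IsConcaveHomog fun a b => -capacityDensity a b where
  toIsLinearGrowth := isLinearGrowth_capacityDensity.neg
  homog r a b _ _ _ := by rw [capacityDensity_mul, mul_neg]
  superadd a b a' b' := superadd_of_concaveOn (Φ := fun a b => -capacityDensity a b)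
    (fun r a b _ _ _ => by rw [capacityDensity_mul, mul_neg]) concaveOn_neg_capacityDensity_simplex

-- The chain rule `I(X₁; Y₁Y₂) + I(X₂; Y₁Y₂X₁) = I(X₁X₂; Y₁Y₂)`, before integration.
theorem minusKernel_add_plusKernel_capacityDensity {a b c d : ℝ} (ha : 0 ≤ a) (hb : 0 ≤ b)
    (hc : 0 ≤ c) (hd : 0 ≤ d) :
    minusKernel capacityDensity a b c d + plusKernel capacityDensity a b c d =
      capacityDensity a b * ((c + d) / 2) + (a + b) / 2 * capacityDensity c d := by
  have hl := (Real.log_pos one_lt_two).ne'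
  have log_mul (x y : ℝ) : x * y * Real.log (x * y) = x * y * Real.log x + x * y * Real.log y := by
    rcases eq_or_ne x 0 with rfl | hx
    · simp
    rcases eq_or_ne y 0 with rfl | hy
    · simp
    rw [Real.log_mul hx hy, mul_add]
  simp only [minusKernel, plusKernel, capacityDensity_mul]
  rw [capacityDensity_eq_log (by positivity) (by positivity),
    capacityDensity_eq_log (by positivity) (by positivity),
    capacityDensity_eq_log (by positivity) (by positivity),
    capacityDensity_eq_log ha hb, capacityDensity_eq_log hc hd,
    show a * c + b * d + (b * c + a * d) = (a + b) * (c + d) by ring, add_comm (b * c) (a * d),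
    log_mul a c, log_mul b d, log_mul a d, log_mul b c, log_mul (a + b) (c + d)]
  field_simp
  ring

namespace BMS

theorem I_eq_avg (P : BMS) : P.I = P.avg capacityDensity := by
  simp only [I, avg, capacityDensity, Fintype.sum_bool, add_comm]

theorem I_nonneg (P : BMS) : 0 ≤ P.I :=
  P.I_eq_avg ▸ P.avg_nonneg fun _ _ => capacityDensity_nonneg

theorem I_le_T (P : BMS) : P.I ≤ P.T :=
  P.I_eq_avg ▸ P.avg_mono isLinearGrowth_capacityDensity isLinearGrowth_abs_sub
    fun _ _ => capacityDensity_le_half_abs_sub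

theorem one_sub_two_mul_Z_le_I (P : BMS) : 1 - 2 * P.Z ≤ P.I := by
  have hZ := isConcaveHomog_sqrt.toIsLinearGrowth.const_mul (-2)
  have h := P.avg_mono (isLinearGrowth_half_add.add hZ) isLinearGrowth_capacityDensity
    fun a b ha hb => by linarith [half_add_sub_le_capacityDensity ha hb]
  rw [P.avg_add isLinearGrowth_half_add hZ, avg_const_mul, avg_half_add, ← Z_eq_avg,
    ← I_eq_avg] at h
  linarith

theorem I_minus_add_I_plus (P : BMS) : P.minus.I + P.plus.I = 2 * P.I := by
  have h := isLinearGrowth_capacityDensity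
  rw [I_eq_avg, I_eq_avg, I_eq_avg, avg_minus, avg_plus P h, ← P.avg₂_symm_mul_half_add h,
    ← avg₂_add P P h.minusKernel h.plusKernel]
  exact avg₂_congr P P fun _ _ _ _ => minusKernel_add_plusKernel_capacityDensity

end BMS

/-! ### Channels as mixtures of binary symmetric channels -/

/-- The value of the average of `Φ` for a binary symmetric channel with crossover probability
`x`. -/
def bscValue (Φ : ℝ → ℝ → ℝ) (x : ℝ) : ℝ := Φ (1 - x) x + Φ x (1 - x)

theorem monotoneOn_Icc_half_of_concaveOn {g : ℝ → ℝ} (hg : ConcaveOn ℝ (Icc 0 1) g)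
    (symm : ∀ x, g (1 - x) = g x) : MonotoneOn g (Icc 0 (1 / 2)) := fun x hx y hy hxy => by
  have hx2 := hx.2
  have hy2 := hy.2
  have h := hg.min_le_of_mem_Icc (x := x) (y := 1 - x) (z := y)
    ⟨hx.1, by linarith⟩ ⟨by linarith, by linarith [hx.1]⟩ ⟨hxy, by linarith⟩
  rwa [symm, min_self] at h

namespace IsConcaveHomog

variable {Φ : ℝ → ℝ → ℝ}

theorem concaveOn_simplex (h : IsConcaveHomog Φ) :
    ConcaveOn ℝ (Icc 0 1) fun x => Φ (1 - x) x := by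
  refine ⟨convex_Icc 0 1, fun x hx y hy p q hp hq hpq => ?_⟩
  have hx' := sub_nonneg.2 hx.2
  have hy' := sub_nonneg.2 hy.2
  simp only [smul_eq_mul]
  rw [← h.homog p _ _ hp hx' hx.1, ← h.homog q _ _ hq hy' hy.1,
    show 1 - (p * x + q * y) = p * (1 - x) + q * (1 - y) by linarith]
  exact h.superadd _ _ _ _ (mul_nonneg hp hx') (mul_nonneg hp hx.1) (mul_nonneg hq hy')
    (mul_nonneg hq hy.1)

theorem concaveOn_bscValue (h : IsConcaveHomog Φ) : ConcaveOn ℝ (Icc 0 1) (bscValue Φ) :=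
  h.concaveOn_simplex.add h.swap.concaveOn_simplex

theorem monotoneOn_bscValue (h : IsConcaveHomog Φ) : MonotoneOn (bscValue Φ) (Icc 0 (1 / 2)) :=
  monotoneOn_Icc_half_of_concaveOn h.concaveOn_bscValue fun x => by
    rw [bscValue, bscValue, sub_sub_cancel, add_comm]

theorem measurable_bscValue (h : IsConcaveHomog Φ) : Measurable (bscValue Φ) :=
  (h.comp_measurable (by fun_prop) (by fun_prop)).add
    (h.comp_measurable (by fun_prop) (by fun_prop))

theorem add_swap_eq_mul_bscValue (h : IsConcaveHomog Φ) {a b : ℝ} (ha : 0 ≤ a) (hb : 0 ≤ b) :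
    Φ a b + Φ b a = (a + b) * bscValue Φ (min a b / (a + b)) := by
  wlog hab : b ≤ a generalizing a b
  · rw [min_comm, add_comm a b, add_comm (Φ a b)]
    exact this hb ha (by linarith)
  rw [min_eq_right hab]
  rcases (add_nonneg ha hb).eq_or_lt with hs | hs
  · obtain ⟨rfl, rfl⟩ : a = 0 ∧ b = 0 := ⟨by linarith, by linarith⟩
    simpa using h.homog 0 0 0 le_rfl le_rfl le_rfl
  · have e : 1 - b / (a + b) = a / (a + b) := by field_simp; ring
    rw [bscValue, e, mul_add, ← h.homog _ _ _ hs.le (by positivity) (by positivity),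
      ← h.homog _ _ _ hs.le (by positivity) (by positivity), mul_div_cancel₀ _ hs.ne',
      mul_div_cancel₀ _ hs.ne']

end IsConcaveHomog

namespace BMS

variable {Φ : ℝ → ℝ → ℝ}

/-- The density of the output when the input is uniform. -/
def outputDensity (P : BMS) (y : P.Y) : ℝ := (P.w false y + P.w true y) / 2

theorem outputDensity_nonneg (P : BMS) (y : P.Y) : 0 ≤ P.outputDensity y :=
  div_nonneg (add_nonneg (P.w_nonneg false y) (P.w_nonneg true y)) two_pos.le

theorem integrable_outputDensity (P : BMS) : Integrable P.outputDensity P.ν :=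
  P.integrable_avg isLinearGrowth_half_add

theorem integral_outputDensity (P : BMS) : ∫ y, P.outputDensity y ∂P.ν = 1 := P.avg_half_add

theorem integrable_outputDensity_mul_bscValue (P : BMS) (h : IsConcaveHomog Φ) {r : P.Y → ℝ}
    (hm : Measurable r) (hr : ∀ y, r y ∈ Icc (0 : ℝ) (1 / 2)) :
    Integrable (fun y => P.outputDensity y * bscValue Φ (r y)) P.ν := by
  obtain ⟨C, -, hC⟩ := h.bound
  refine P.integrable_outputDensity.mul_bdd (c := 2 * C)
    (h.measurable_bscValue.comp hm).aestronglyMeasurable (Eventually.of_forall fun y => ?_)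
  have h1 := hC (1 - r y) (r y) (by linarith [(hr y).2]) (hr y).1
  have h2 := hC (r y) (1 - r y) (hr y).1 (by linarith [(hr y).2])
  exact (abs_add_le _ _).trans (by linarith)

theorem avg_eq_integral_bscValue (P : BMS) (h : IsConcaveHomog Φ) :
    P.avg Φ = ∫ y, P.outputDensity y * bscValue Φ (P.chi y) ∂P.ν := by
  have symmetrized : P.avg Φ + P.avg (fun a b => Φ b a) =
      ∫ y, 2 * (P.outputDensity y * bscValue Φ (P.chi y)) ∂P.ν := by
    rw [← avg_add P h.toIsLinearGrowth h.swap.toIsLinearGrowth, avg]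
    refine integral_congr_ae (Eventually.of_forall fun y => ?_)
    simp only [h.add_swap_eq_mul_bscValue (P.w_nonneg _ _) (P.w_nonneg _ _), outputDensity, chi]
    ring
  rw [P.avg_swap Φ, integral_const_mul] at symmetrized
  linarith

end BMS

/-- The sum of `p * g x` over the masses `(p, x)` of a list. -/
def massSum (g : ℝ → ℝ) (l : List (ℝ × ℝ)) : ℝ := (l.map fun a => a.1 * g a.2).sum

theorem sum_setIntegral_preimage_mul {α : Type*} [MeasurableSpace α] {μ : Measure α}
    {ρ r : α → ℝ} (hρ : Integrable ρ μ) (hm : Measurable r) (hr : (range r).Finite) (g : ℝ → ℝ) :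
    ∑ x ∈ hr.toFinset, (∫ y in r ⁻¹' {x}, ρ y ∂μ) * g x = ∫ y, ρ y * g (r y) ∂μ := by
  have hms (x : ℝ) : MeasurableSet (r ⁻¹' {x}) := hm (measurableSet_singleton x)
  have hcongr (x : ℝ) : EqOn (fun y => ρ y * g x) (fun y => ρ y * g (r y)) (r ⁻¹' {x}) :=
    fun y (hy : r y = x) => by simp only [hy]
  have hcover : ⋃ x ∈ hr.toFinset, r ⁻¹' {x} = univ := by
    ext y
    simp
  rw [← setIntegral_univ, ← hcover, integral_biUnion_finset _ fun x _ => hms x]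
  · refine Finset.sum_congr rfl fun x _ => ?_
    rw [← setIntegral_congr_fun (hms x) (hcongr x), integral_mul_const]
  · exact fun x _ x' _ hne => Disjoint.preimage _ (by simpa using hne)
  · exact fun x _ => (hρ.mul_const (g x)).integrableOn.congr_fun (hcongr x) (hms x)

namespace BMS

variable {Φ : ℝ → ℝ → ℝ}

open Classical in
/-- The list of masses of the channel in which the output `y` is assigned the crossover
probability `r y`. -/
def massesOf (P : BMS) (r : P.Y → ℝ) (hr : (range r).Finite) : List (ℝ × ℝ) :=
  ((hr.toFinset.filter fun x => 0 < ∫ y in r ⁻¹' {x}, P.outputDensity y ∂P.ν).sort (· ≤ ·)).map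
    fun x => (∫ y in r ⁻¹' {x}, P.outputDensity y ∂P.ν, x)

theorem masses_eq_massesOf (P : BMS) [Finite P.Y] :
    P.masses = P.massesOf P.chi (finite_range _) := rfl

theorem of_mem_massesOf {P : BMS} {r : P.Y → ℝ} {hr : (range r).Finite} {a : ℝ × ℝ}
    (ha : a ∈ P.massesOf r hr) :
    0 < a.1 ∧ a.2 ∈ range r := by
  simp only [massesOf, List.mem_map, Finset.mem_sort, Finset.mem_filter,
    Set.Finite.mem_toFinset] at ha
  obtain ⟨x, ⟨hx, hpos⟩, rfl⟩ := ha
  exact ⟨hpos, hx⟩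

theorem length_massesOf_le (P : BMS) (r : P.Y → ℝ) (hr : (range r).Finite) :
    (P.massesOf r hr).length ≤ (range r).ncard := by
  rw [massesOf, List.length_map, Finset.length_sort, ncard_eq_toFinset_card _ hr]
  exact Finset.card_filter_le _ _

theorem massSum_massesOf (P : BMS) {r : P.Y → ℝ} (hm : Measurable r) (hr : (range r).Finite)
    (g : ℝ → ℝ) : massSum g (P.massesOf r hr) = ∫ y, P.outputDensity y * g (r y) ∂P.ν := by
  classical
  set m : ℝ → ℝ := fun x => ∫ y in r ⁻¹' {x}, P.outputDensity y ∂P.ν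
  have hm0 (x : ℝ) : 0 ≤ m x := integral_nonneg P.outputDensity_nonneg
  calc massSum g (P.massesOf r hr) = ∑ x ∈ hr.toFinset with 0 < m x, m x * g x := by
        rw [massSum, massesOf, List.map_map, ← Finset.sum_map_toList]
        exact ((Finset.sort_perm_toList _ (· ≤ ·)).map _).sum_eq
    _ = ∑ x ∈ hr.toFinset, m x * g x :=
        Finset.sum_filter_of_ne fun x _ hx => (hm0 x).lt_of_ne' (left_ne_zero_of_mul hx)
    _ = ∫ y, P.outputDensity y * g (r y) ∂P.ν :=
        sum_setIntegral_preimage_mul P.integrable_outputDensity hm hr g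

theorem isMassList_massesOf (P : BMS) {r : P.Y → ℝ} (hm : Measurable r) (hr : (range r).Finite)
    (h : ∀ y, r y ∈ Icc (0 : ℝ) (1 / 2)) : IsMassList (P.massesOf r hr) := by
  constructor
  · intro a ha
    obtain ⟨hpos, y, hy⟩ := of_mem_massesOf ha
    exact ⟨hpos, hy ▸ h y⟩
  · simpa only [massSum, mul_one, integral_outputDensity] using P.massSum_massesOf hm hr fun _ => 1

theorem avg_ofMasses (l : List (ℝ × ℝ)) (hl : IsMassList l) (h : IsConcaveHomog Φ) :
    (ofMasses l hl).avg Φ = massSum (bscValue Φ) l := by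
  have sum_bool (i : Fin l.length) : ∑ c : Bool,
      Φ ((ofMasses l hl).w false (i, c)) ((ofMasses l hl).w true (i, c)) =
      (l.get i).1 * bscValue Φ (l.get i).2 := by
    obtain ⟨h1, h2, h3⟩ := hl.1 _ (l.get_mem i)
    simp only [ofMasses, Fintype.sum_bool, if_true, reduceCtorEq, if_false]
    rw [h.homog _ _ _ h1.le h2 (by linarith), h.homog _ _ _ h1.le (by linarith) h2, bscValue,
      ← mul_add, add_comm]
  calc (ofMasses l hl).avg Φ = ∑ i : Fin l.length, (l.get i).1 * bscValue Φ (l.get i).2 :=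
        (integral_count (X := Fin l.length × Bool) _).trans <|
          (Fintype.sum_prod_type _).trans (Finset.sum_congr rfl fun i _ => sum_bool i)
    _ = massSum (bscValue Φ) l := by
        rw [massSum, ← List.sum_ofFn]
        exact congrArg List.sum (by
          conv_rhs => rw [← List.ofFn_get l, List.map_ofFn]
          rfl)

theorem card_ofMasses (l : List (ℝ × ℝ)) (hl : IsMassList l) :
    Nat.card (ofMasses l hl).Y = 2 * l.length := by
  change Nat.card (Fin l.length × Bool) = _
  simp [mul_comm]

theorem finite_ofMasses (l : List (ℝ × ℝ)) (hl : IsMassList l) : Finite (ofMasses l hl).Y :=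
  inferInstanceAs (Finite (Fin l.length × Bool))

theorem avg_eq_massSum_masses (P : BMS) [Finite P.Y] (h : IsConcaveHomog Φ) :
    P.avg Φ = massSum (bscValue Φ) P.masses := by
  rw [masses_eq_massesOf, P.massSum_massesOf P.measurable_chi, P.avg_eq_integral_bscValue h]

theorem length_masses_le (P : BMS) [Finite P.Y] : P.masses.length ≤ Nat.card P.Y := by
  rw [masses_eq_massesOf]
  refine (P.length_massesOf_le _ _).trans ?_
  rw [← image_univ, ← ncard_univ]
  exact ncard_image_le

theorem pairwise_masses (P : BMS) [Finite P.Y] : P.masses.Pairwise fun a b => a.2 ≤ b.2 := by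
  rw [masses, List.pairwise_map]
  exact Finset.pairwise_sort _ _

end BMS

/-! ### Rounding the crossover probabilities -/

/-- `x`, rounded up to a multiple of `1 / (2 * (M + 1))`. -/
def gridCeil (M : ℕ) (x : ℝ) : ℝ := ⌈2 * (M + 1) * x⌉₊ / (2 * (M + 1))

theorem measurable_gridCeil (M : ℕ) : Measurable (gridCeil M) :=
  (measurable_from_top.comp (Nat.measurable_ceil.comp (measurable_const_mul _))).div_const _

theorem le_gridCeil (M : ℕ) (x : ℝ) : x ≤ gridCeil M x := by
  rw [gridCeil, le_div_iff₀ (by positivity), mul_comm]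
  exact Nat.le_ceil _

theorem gridCeil_le_add (M : ℕ) {x : ℝ} (hx : 0 ≤ x) :
    gridCeil M x ≤ x + 1 / (2 * (M + 1)) := by
  have h := (Nat.ceil_lt_add_one (a := 2 * ((M : ℝ) + 1) * x) (by positivity)).le
  rw [gridCeil, div_le_iff₀ (by positivity), add_mul, div_mul_cancel₀ _ (by positivity)]
  linarith

theorem ceil_mul_le_of_le_half (M : ℕ) {x : ℝ} (hx : x ≤ 1 / 2) :
    ⌈2 * ((M : ℝ) + 1) * x⌉₊ ≤ M + 1 := by
  have h := mul_le_mul_of_nonneg_left hx (show 0 ≤ 2 * ((M : ℝ) + 1) by positivity)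
  rw [Nat.ceil_le]
  push_cast
  linarith

theorem gridCeil_mem_Icc (M : ℕ) {x : ℝ} (hx : x ∈ Icc (0 : ℝ) (1 / 2)) :
    gridCeil M x ∈ Icc (0 : ℝ) (1 / 2) := by
  have h : (⌈2 * ((M : ℝ) + 1) * x⌉₊ : ℝ) ≤ M + 1 := by
    exact_mod_cast ceil_mul_le_of_le_half M hx.2
  refine ⟨hx.1.trans (le_gridCeil M x), ?_⟩
  rw [gridCeil, div_le_iff₀ (by positivity)]
  linarith

theorem gridCeil_mem_image (M : ℕ) {x : ℝ} (hx : x ≤ 1 / 2) :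
    gridCeil M x ∈ (fun j : ℕ => (j : ℝ) / (2 * (M + 1))) '' Iio (M + 2) :=
  ⟨_, Nat.lt_succ_of_le (ceil_mul_le_of_le_half M hx), rfl⟩

theorem exists_abs_gridCeil_sub_le {g : ℝ → ℝ} (hg : ContinuousOn g (Icc 0 (1 / 2))) {ε : ℝ}
    (hε : 0 < ε) : ∃ M, ∀ x ∈ Icc (0 : ℝ) (1 / 2), |g (gridCeil M x) - g x| ≤ ε := by
  obtain ⟨η, hη, hu⟩ := Metric.uniformContinuousOn_iff.1
    (isCompact_Icc.uniformContinuousOn_of_continuous hg) ε hε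
  obtain ⟨M, hM⟩ := exists_nat_one_div_lt hη
  refine ⟨M, fun x hx => (hu _ (gridCeil_mem_Icc M hx) x hx ?_).le⟩
  rw [Real.dist_eq, abs_of_nonneg (sub_nonneg.2 (le_gridCeil M x))]
  calc gridCeil M x - x ≤ 1 / (2 * (M + 1)) := by linarith [gridCeil_le_add M hx.1]
    _ ≤ 1 / (M + 1) := one_div_le_one_div_of_le (by positivity) (by linarith)
    _ < η := hM

namespace BMS

variable {Φ : ℝ → ℝ → ℝ}

theorem range_gridCeil_chi_subset (P : BMS) (M : ℕ) :
    range (fun y => gridCeil M (P.chi y)) ⊆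
      (fun j : ℕ => (j : ℝ) / (2 * (M + 1))) '' Iio (M + 2) :=
  range_subset_iff.2 fun y => gridCeil_mem_image M (P.chi_mem y).2

/-- The channel obtained by rounding all crossover probabilities up to a grid of `M + 2` points. -/
def gridQuantize (P : BMS) (M : ℕ) : BMS :=
  ofMasses
    (P.massesOf (fun y => gridCeil M (P.chi y))
      (((finite_Iio _).image _).subset (P.range_gridCeil_chi_subset M)))
    (P.isMassList_massesOf ((measurable_gridCeil M).comp P.measurable_chi) _
      fun y => gridCeil_mem_Icc M (P.chi_mem y))

theorem card_gridQuantize_le (P : BMS) (M : ℕ) :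
    Nat.card (P.gridQuantize M).Y ≤ 2 * (M + 2) := by
  rw [gridQuantize, card_ofMasses]
  refine Nat.mul_le_mul_left 2 ((P.length_massesOf_le _ _).trans ?_)
  calc _ ≤ ((fun j : ℕ => (j : ℝ) / (2 * (M + 1))) '' Iio (M + 2)).ncard :=
        ncard_le_ncard (P.range_gridCeil_chi_subset M) ((finite_Iio _).image _)
    _ ≤ (Iio (M + 2)).ncard := ncard_image_le (finite_Iio _)
    _ = M + 2 := by rw [← Finset.coe_Iio, ncard_coe_finset, Nat.card_Iio]

theorem avg_gridQuantize (P : BMS) (M : ℕ) (h : IsConcaveHomog Φ) :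
    (P.gridQuantize M).avg Φ =
      ∫ y, P.outputDensity y * bscValue Φ (gridCeil M (P.chi y)) ∂P.ν := by
  rw [gridQuantize, avg_ofMasses _ _ h]
  exact P.massSum_massesOf ((measurable_gridCeil M).comp P.measurable_chi) _ _

theorem integrable_outputDensity_mul_bscValue_gridCeil (P : BMS) (M : ℕ) (h : IsConcaveHomog Φ) :
    Integrable (fun y => P.outputDensity y * bscValue Φ (gridCeil M (P.chi y))) P.ν :=
  P.integrable_outputDensity_mul_bscValue h ((measurable_gridCeil M).comp P.measurable_chi)
    fun y => gridCeil_mem_Icc M (P.chi_mem y)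

theorem degradesTo_gridQuantize (P : BMS) (M : ℕ) : P.DegradesTo (P.gridQuantize M) := by
  intro Φ h
  rw [P.avg_gridQuantize M h, P.avg_eq_integral_bscValue h]
  refine integral_mono (P.integrable_outputDensity_mul_bscValue h P.measurable_chi P.chi_mem)
    (P.integrable_outputDensity_mul_bscValue_gridCeil M h) fun y => ?_
  exact mul_le_mul_of_nonneg_left (h.monotoneOn_bscValue (P.chi_mem y)
    (gridCeil_mem_Icc M (P.chi_mem y)) (le_gridCeil M _)) (P.outputDensity_nonneg y)

theorem exists_abs_avg_gridQuantize_sub_le (h : IsConcaveHomog Φ)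
    (hc : ContinuousOn (bscValue Φ) (Icc 0 (1 / 2))) {ε : ℝ} (hε : 0 < ε) :
    ∃ M, ∀ P : BMS, |(P.gridQuantize M).avg Φ - P.avg Φ| ≤ ε := by
  obtain ⟨M, hM⟩ := exists_abs_gridCeil_sub_le hc hε
  refine ⟨M, fun P => ?_⟩
  have hε' : ∫ y, P.outputDensity y * ε ∂P.ν = ε := by
    rw [integral_mul_const, P.integral_outputDensity, one_mul]
  rw [P.avg_gridQuantize M h, P.avg_eq_integral_bscValue h,
    ← integral_sub (P.integrable_outputDensity_mul_bscValue_gridCeil M h)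
      (P.integrable_outputDensity_mul_bscValue h P.measurable_chi P.chi_mem), ← hε']
  rw [← Real.norm_eq_abs]
  refine norm_integral_le_of_norm_le (P.integrable_outputDensity.mul_const ε)
    (Eventually.of_forall fun y => ?_)
  rw [← mul_sub, norm_mul, Real.norm_of_nonneg (P.outputDensity_nonneg y)]
  exact mul_le_mul_of_nonneg_left (hM _ (P.chi_mem y)) (P.outputDensity_nonneg y)

theorem exists_abs_I_gridQuantize_sub_le {ε : ℝ} (hε : 0 < ε) :
    ∃ M, ∀ P : BMS, |(P.gridQuantize M).I - P.I| ≤ ε := by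
  have hc : ContinuousOn (bscValue fun a b => -capacityDensity a b) (Icc 0 (1 / 2)) := by
    refine ContinuousOn.congr (f := fun x => Real.binEntropy x / Real.log 2 - 1)
      ((Real.binEntropy_continuous.div_const _).sub continuous_const).continuousOn fun x hx => ?_
    have hx1 : x ≤ 1 := hx.2.trans (by norm_num)
    have h := capacityDensity_simplex (x := 1 - x) ⟨sub_nonneg.2 hx1, sub_le_self 1 hx.1⟩
    rw [sub_sub_cancel, Real.binEntropy_one_sub] at h
    rw [bscValue, capacityDensity_simplex ⟨hx.1, hx1⟩, h]
    field_simp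
    ring
  obtain ⟨M, hM⟩ := exists_abs_avg_gridQuantize_sub_le isConcaveHomog_neg_capacityDensity hc hε
  refine ⟨M, fun P => ?_⟩
  have h := hM P
  rwa [avg_neg, avg_neg, ← I_eq_avg, ← I_eq_avg, neg_sub_neg, abs_sub_comm] at h

end BMS

/-! ### The greedy algorithms degrade -/

theorem massCentre_mem_Icc {a b : ℝ × ℝ} (ha : 0 < a.1) (hb : 0 < b.1) (hab : a.2 ≤ b.2) :
    massCentre a b ∈ Icc a.2 b.2 := by
  have hs : 0 < a.1 + b.1 := add_pos ha hb
  exact (convex_Icc a.2 b.2) ⟨le_rfl, hab⟩ ⟨hab, le_rfl⟩ (div_pos ha hs).le (div_pos hb hs).le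
    (by rw [← add_div, div_self hs.ne'])

namespace MassAlgorithm

variable {g : ℝ → ℝ}

theorem join_snd_mem_Icc (A : MassAlgorithm) {a b : ℝ × ℝ} (ha : 0 < a.1) (hb : 0 < b.1)
    (hab : a.2 ≤ b.2) : (A.join a b).2 ∈ Icc a.2 b.2 := by
  cases A
  · exact ⟨hab, le_rfl⟩
  · exact massCentre_mem_Icc ha hb hab

theorem add_le_join (A : MassAlgorithm) (hg : ConcaveOn ℝ (Icc 0 (1 / 2)) g)
    (hm : MonotoneOn g (Icc 0 (1 / 2))) {a b : ℝ × ℝ}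
    (ha : 0 < a.1 ∧ 0 ≤ a.2 ∧ a.2 ≤ 1 / 2) (hb : 0 < b.1 ∧ 0 ≤ b.2 ∧ b.2 ≤ 1 / 2)
    (hab : a.2 ≤ b.2) : a.1 * g a.2 + b.1 * g b.2 ≤ (A.join a b).1 * g (A.join a b).2 := by
  cases A with
  | transportation =>
    simp only [join, add_mul]
    linarith [mul_le_mul_of_nonneg_left (hm ha.2 hb.2 hab) ha.1.le]
  | merging =>
    have hs : 0 < a.1 + b.1 := add_pos ha.1 hb.1
    have jensen := hg.2 ha.2 hb.2 (div_pos ha.1 hs).le (div_pos hb.1 hs).le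
      (by rw [← add_div, div_self hs.ne'])
    calc a.1 * g a.2 + b.1 * g b.2
        = (a.1 + b.1) * (a.1 / (a.1 + b.1) * g a.2 + b.1 / (a.1 + b.1) * g b.2) := by field_simp
      _ ≤ (a.1 + b.1) * g (massCentre a b) := mul_le_mul_of_nonneg_left jensen hs.le

theorem le_snd_of_mem_joinAt (A : MassAlgorithm) (j : ℕ) (l : List (ℝ × ℝ)) (c : ℝ)
    (h : ∀ a ∈ l, 0 < a.1) (hl : l.Pairwise fun a b => a.2 ≤ b.2) (hc : ∀ a ∈ l, c ≤ a.2) :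
    ∀ a ∈ A.joinAt j l, c ≤ a.2 := by
  fun_induction joinAt A j l with
  | case1 a b t =>
    simp only [List.forall_mem_cons] at h hc ⊢
    have hj := A.join_snd_mem_Icc h.1 h.2.1 (List.rel_of_pairwise_cons hl (by simp))
    exact ⟨hc.1.trans hj.1, hc.2.2⟩
  | case2 j a t ih =>
    simp only [List.forall_mem_cons] at h hc ⊢
    exact ⟨hc.1, ih h.2 hl.of_cons hc.2⟩
  | case3 => exact hc

theorem pairwise_joinAt (A : MassAlgorithm) (j : ℕ) (l : List (ℝ × ℝ))
    (h : ∀ a ∈ l, 0 < a.1) (hl : l.Pairwise fun a b => a.2 ≤ b.2) :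
    (A.joinAt j l).Pairwise fun a b => a.2 ≤ b.2 := by
  fun_induction joinAt A j l with
  | case1 a b t =>
    simp only [List.forall_mem_cons] at h
    have hj := A.join_snd_mem_Icc h.1 h.2.1 (List.rel_of_pairwise_cons hl (by simp))
    exact List.pairwise_cons.2
      ⟨fun x hx => hj.2.trans (List.rel_of_pairwise_cons hl.of_cons hx), hl.of_cons.of_cons⟩
  | case2 j a t ih =>
    simp only [List.forall_mem_cons] at h
    exact List.pairwise_cons.2 ⟨A.le_snd_of_mem_joinAt j t a.2 h.2 hl.of_cons
      fun y hy => List.rel_of_pairwise_cons hl hy, ih h.2 hl.of_cons⟩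
  | case3 => exact hl

theorem massSum_le_massSum_joinAt (A : MassAlgorithm) (hg : ConcaveOn ℝ (Icc 0 (1 / 2)) g)
    (hm : MonotoneOn g (Icc 0 (1 / 2))) (j : ℕ) (l : List (ℝ × ℝ))
    (h : ∀ a ∈ l, 0 < a.1 ∧ 0 ≤ a.2 ∧ a.2 ≤ 1 / 2) (hl : l.Pairwise fun a b => a.2 ≤ b.2) :
    massSum g l ≤ massSum g (A.joinAt j l) := by
  fun_induction joinAt A j l with
  | case1 a b t =>
    simp only [List.forall_mem_cons] at h
    simp only [massSum, List.map_cons, List.sum_cons]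
    linarith [A.add_le_join hg hm h.1 h.2.1 (List.rel_of_pairwise_cons hl (by simp))]
  | case2 j a t ih =>
    simp only [List.forall_mem_cons] at h
    simp only [massSum, List.map_cons, List.sum_cons]
    exact add_le_add_right (ih h.2 hl.of_cons) _
  | case3 => exact le_rfl

theorem pairwise_step (A : MassAlgorithm) (f : ℝ → ℝ) {l : List (ℝ × ℝ)} (h : IsMassList l)
    (hl : l.Pairwise fun a b => a.2 ≤ b.2) : (A.step f l).Pairwise fun a b => a.2 ≤ b.2 := by
  unfold step
  split
  · exact A.pairwise_joinAt _ l (fun a ha => (h.1 a ha).1) hl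
  · exact hl

theorem massSum_le_massSum_step (A : MassAlgorithm) (f : ℝ → ℝ)
    (hg : ConcaveOn ℝ (Icc 0 (1 / 2)) g) (hm : MonotoneOn g (Icc 0 (1 / 2))) {l : List (ℝ × ℝ)}
    (h : IsMassList l) (hl : l.Pairwise fun a b => a.2 ≤ b.2) :
    massSum g l ≤ massSum g (A.step f l) := by
  unfold step
  split
  · exact A.massSum_le_massSum_joinAt hg hm _ l h.1 hl
  · exact le_rfl

theorem massSum_le_massSum_run (A : MassAlgorithm) (f : ℝ → ℝ)
    (hg : ConcaveOn ℝ (Icc 0 (1 / 2)) g) (hm : MonotoneOn g (Icc 0 (1 / 2))) (k : ℕ)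
    {l : List (ℝ × ℝ)} (h : IsMassList l) (hl : l.Pairwise fun a b => a.2 ≤ b.2) :
    massSum g l ≤ massSum g (A.run f k l) := by
  unfold run
  generalize l.length - k = n
  induction n generalizing l with
  | zero => exact le_rfl
  | succ n ih =>
    rw [Function.iterate_succ_apply]
    exact (A.massSum_le_massSum_step f hg hm h hl).trans
      (ih (h.step A f) (A.pairwise_step f h hl))

theorem length_joinAt (A : MassAlgorithm) (j : ℕ) (l : List (ℝ × ℝ)) (h : j + 1 < l.length) :
    (A.joinAt j l).length = l.length - 1 := by
  fun_induction joinAt A j l with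
  | case1 a b t => simp
  | case2 j a t ih =>
    simp only [List.length_cons] at h ⊢
    rw [ih (by omega)]
    omega
  | case3 j l h1 h2 => rcases j with _ | j <;> rcases l with _ | ⟨a, _ | ⟨b, t⟩⟩ <;> simp_all

theorem length_costs (A : MassAlgorithm) (f : ℝ → ℝ) (l : List (ℝ × ℝ)) :
    (A.costs f l).length = l.length - 1 := by
  fun_induction costs A f l with
  | case1 a b t ih => simp [ih]
  | case2 l h => rcases l with _ | ⟨a, _ | ⟨b, t⟩⟩ <;> simp_all

theorem length_step (A : MassAlgorithm) (f : ℝ → ℝ) (l : List (ℝ × ℝ)) :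
    (A.step f l).length = max (l.length - 1) (min l.length 1) := by
  unfold step
  split
  case h_1 j hj =>
    have hj := List.mem_range.1 (List.argmin_mem hj)
    rw [length_costs] at hj
    rw [A.length_joinAt j l (by omega)]
    omega
  case h_2 hj =>
    rw [List.argmin_eq_none, List.range_eq_nil, length_costs] at hj
    omega

theorem length_iterate_step (A : MassAlgorithm) (f : ℝ → ℝ) (n : ℕ) (l : List (ℝ × ℝ)) :
    ((A.step f)^[n] l).length = max (l.length - n) (min l.length 1) := by
  induction n with
  | zero => simp
  | succ n ih =>
    rw [Function.iterate_succ_apply', length_step, ih]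
    omega

theorem length_run_le (A : MassAlgorithm) (f : ℝ → ℝ) {k : ℕ} (hk : 1 ≤ k) (l : List (ℝ × ℝ)) :
    (A.run f k l).length ≤ k := by
  rw [run, length_iterate_step]
  omega

theorem length_run_le_length (A : MassAlgorithm) (f : ℝ → ℝ) (k : ℕ) (l : List (ℝ × ℝ)) :
    (A.run f k l).length ≤ l.length := by
  rw [run, length_iterate_step]
  omega

theorem run_of_length_le (A : MassAlgorithm) (f : ℝ → ℝ) {k : ℕ} {l : List (ℝ × ℝ)}
    (h : l.length ≤ k) : A.run f k l = l := by
  rw [run, Nat.sub_eq_zero_of_le h, Function.iterate_zero_apply]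

end MassAlgorithm

/-! ### Erasure channels -/

theorem capacityDensity_self (a : ℝ) : capacityDensity a a = 0 := by
  rw [capacityDensity, ← add_mul, show 1 / 2 * a + 1 / 2 * a = a by ring]
  rcases eq_or_ne a 0 with rfl | ha
  · simp
  · simp [div_self ha]

theorem capacityDensity_zero_right (a : ℝ) : capacityDensity a 0 = a / 2 := by
  have h := capacityDensity_mul a 1 0
  rw [mul_one, mul_zero] at h
  rw [h]
  norm_num [capacityDensity, div_eq_mul_inv]

theorem capacityDensity_comm (a b : ℝ) : capacityDensity a b = capacityDensity b a := by
  rw [capacityDensity, capacityDensity, add_comm (1 / 2 * a) (1 / 2 * b), add_comm]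

namespace BMS

/-- Every output symbol either determines the input or is an erasure: it carries no information
about the input.  Such channels are erasure channels with a relabelled output. -/
def IsErasure (P : BMS) : Prop :=
  ∀ y, P.w false y = 0 ∨ P.w true y = 0 ∨ P.w false y = P.w true y

theorem isErasure_bec (e : ℝ) (h0 : 0 ≤ e) (h1 : e ≤ 1) : (bec e h0 h1).IsErasure
  | none => .inr (.inr rfl)
  | some false => .inr (.inl (by simp [bec]))
  | some true => .inl (by simp [bec])

theorem Z_bec (e : ℝ) (h0 : 0 ≤ e) (h1 : e ≤ 1) : (bec e h0 h1).Z = e := by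
  let _ : MeasurableSpace (Option Bool) := ⊤
  refine (integral_count (X := Option Bool) _).trans ?_
  rw [Fintype.sum_option]
  simp [bec, Real.sqrt_mul_self h0]

namespace IsErasure

variable {P : BMS}

theorem minus (h : P.IsErasure) : P.minus.IsErasure := by
  intro y
  simp only [BMS.minus, Fintype.sum_bool, Bool.xor_false, Bool.xor_true, Bool.not_false,
    Bool.not_true]
  rcases h y.1 with h₁ | h₁ | h₁ <;> rcases h y.2 with h₂ | h₂ | h₂ <;>
    simp [h₁, h₂, add_comm]

theorem plus (h : P.IsErasure) : P.plus.IsErasure := by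
  rintro ⟨y₁, y₂, u⟩
  simp only [BMS.plus]
  rcases h y₁ with h₁ | h₁ | h₁ <;> rcases h y₂ with h₂ | h₂ | h₂ <;> cases u <;> simp [h₁, h₂]

theorem child (h : P.IsErasure) (b : Bool) : (P.child b).IsErasure := by
  cases b
  · exact h.minus
  · exact h.plus

theorem avg_congr (h : P.IsErasure) {Φ Ψ : ℝ → ℝ → ℝ} (left : ∀ a, 0 ≤ a → Φ a 0 = Ψ a 0)
    (right : ∀ a, 0 ≤ a → Φ 0 a = Ψ 0 a) (diag : ∀ a, 0 ≤ a → Φ a a = Ψ a a) :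
    P.avg Φ = P.avg Ψ := by
  refine integral_congr_ae (Eventually.of_forall fun y => ?_)
  rcases h y with e | e | e <;> simp only [e]
  · exact right _ (P.w_nonneg _ _)
  · exact left _ (P.w_nonneg _ _)
  · exact diag _ (P.w_nonneg _ _)

theorem T_add_Z (h : P.IsErasure) : P.T + P.Z = 1 := by
  rw [Z_eq_avg, T, ← avg_add P isLinearGrowth_abs_sub isConcaveHomog_sqrt.toIsLinearGrowth,
    ← P.avg_half_add]
  refine h.avg_congr (fun a ha => ?_) (fun a ha => ?_) fun a ha => ?_
  · simp [abs_of_nonneg ha]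
  · simp [abs_of_nonneg ha]
  · simp [Real.sqrt_mul_self ha]

theorem I_eq_T (h : P.IsErasure) : P.I = P.T := by
  rw [I_eq_avg]
  refine h.avg_congr (fun a ha => ?_) (fun a ha => ?_) fun a _ => ?_
  · rw [capacityDensity_zero_right, sub_zero, abs_of_nonneg ha]
  · rw [capacityDensity_comm, capacityDensity_zero_right, zero_sub, abs_neg, abs_of_nonneg ha]
  · rw [capacityDensity_self, sub_self, abs_zero, zero_div]

theorem Z_minus (h : P.IsErasure) : P.minus.Z = 2 * P.Z - P.Z ^ 2 := by
  have := h.minus.T_add_Z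
  rw [T_minus, ← sub_eq_of_eq_add h.T_add_Z.symm] at this
  linarith

theorem Z_child_le (h : P.IsErasure) {R : BMS} (hZ : R.Z ≤ P.Z) (b : Bool) :
    (R.child b).Z ≤ (P.child b).Z := by
  have hR := R.Z_nonneg
  cases b
  · calc R.minus.Z ≤ 2 * R.Z - R.Z ^ 2 := R.Z_minus_le
      _ ≤ 2 * P.Z - P.Z ^ 2 := by nlinarith [P.Z_le_one]
      _ = P.minus.Z := h.Z_minus.symm
  · calc R.plus.Z = R.Z ^ 2 := R.Z_plus
      _ ≤ P.Z ^ 2 := pow_le_pow_left₀ hR hZ 2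
      _ = P.plus.Z := P.Z_plus.symm

theorem T_minus_add_T_plus (h : P.IsErasure) : P.minus.T + P.plus.T = 2 * P.T := by
  have := h.plus.T_add_Z
  rw [Z_plus, ← sub_eq_of_eq_add' h.T_add_Z.symm] at this
  linarith [P.T_minus]

theorem chi_eq (h : P.IsErasure) (y : P.Y) : P.chi y = 0 ∨ P.chi y = 1 / 2 := by
  unfold chi
  rcases h y with e | e | e
  · simp [e, P.w_nonneg]
  · simp [e, P.w_nonneg]
  · rw [e, min_self]
    rcases eq_or_ne (P.w true y) 0 with e' | e'
    · simp [e']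
    · right
      field_simp
      norm_num

theorem length_masses_le [Finite P.Y] (h : P.IsErasure) : P.masses.length ≤ 2 := by
  have hsub : range P.chi ⊆ {0, 1 / 2} := range_subset_iff.2 h.chi_eq
  calc P.masses.length ≤ (range P.chi).ncard := P.length_massesOf_le _ (finite_range _)
    _ ≤ ({0, 1 / 2} : Set ℝ).ncard := ncard_le_ncard hsub
    _ = 2 := ncard_pair (by norm_num)

theorem ofMasses_masses [Finite P.Y] (h : P.IsErasure) :
    (ofMasses P.masses P.isMassList_masses).IsErasure := by
  rintro ⟨i, c⟩
  obtain ⟨-, y, hy⟩ := of_mem_massesOf (P.masses.get_mem i)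
  simp only [ofMasses, ← hy]
  rcases h.chi_eq y with e | e <;> cases c <;> norm_num [e]

end IsErasure

theorem abs_I_bec_sub_le (P : BMS) : |(bec P.Z P.Z_nonneg P.Z_le_one).I - P.I| ≤ P.Z := by
  have h := isErasure_bec P.Z P.Z_nonneg P.Z_le_one
  have hT := h.T_add_Z
  rw [Z_bec] at hT
  rw [h.I_eq_T, abs_le]
  constructor <;> linarith [P.I_le_T, P.T_le_one, P.one_sub_two_mul_Z_le_I]

end BMS

/-! ### Threshold quantizers -/

namespace BMS

instance finite_child (P : BMS) [Finite P.Y] (b : Bool) : Finite (P.child b).Y := by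
  cases b
  · exact inferInstanceAs (Finite (P.Y × P.Y))
  · exact inferInstanceAs (Finite (P.Y × P.Y × Bool))

theorem card_child_le (P : BMS) (b : Bool) : Nat.card (P.child b).Y ≤ 2 * Nat.card P.Y ^ 2 := by
  cases b
  · change Nat.card (P.Y × P.Y) ≤ _
    rw [Nat.card_prod]
    nlinarith
  · change Nat.card (P.Y × P.Y × Bool) ≤ _
    rw [Nat.card_prod, Nat.card_prod, Nat.card_eq_fintype_card (α := Bool), Fintype.card_bool]
    nlinarith

theorem quantSub_even (Q : BMS → BMS) (W : BMS) (n i : ℕ) :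
    quantSub Q W (n + 1) (2 * i) = Q ((quantSub Q W n i).child false) := by
  rw [quantSub, show 2 * i / 2 = i by omega, show 2 * i % 2 = 0 by omega]
  rfl

theorem quantSub_odd (Q : BMS → BMS) (W : BMS) (n i : ℕ) :
    quantSub Q W (n + 1) (2 * i + 1) = Q ((quantSub Q W n i).child true) := by
  rw [quantSub, show (2 * i + 1) / 2 = i by omega, show (2 * i + 1) % 2 = 1 by omega]
  rfl

/-- The properties of the mass algorithms on which the analysis of the quantized tree rests:
below the threshold `δ` for the Bhattacharyya parameter a channel becomes an erasure channel, above
it is degraded, and this without loss if it has at most `m` masses. -/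
structure IsThresholdQuantizer (δ : ℝ) (m : ℕ) (Q : BMS → BMS) : Prop where
  finite : ∀ P, Finite (Q P).Y
  card_le : ∀ P [Finite P.Y], Nat.card (Q P).Y ≤ 2 * Nat.card P.Y + 3
  eq_bec : ∀ P : BMS, P.Z < δ → Q P = bec P.Z P.Z_nonneg P.Z_le_one
  degradesTo : ∀ P : BMS, δ ≤ P.Z → P.DegradesTo (Q P)
  eq_ofMasses : ∀ P [Finite P.Y], δ ≤ P.Z → P.masses.length ≤ m →
    Q P = ofMasses P.masses P.isMassList_masses

namespace IsThresholdQuantizer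

variable {δ : ℝ} {m : ℕ} {Q : BMS → BMS} (hQ : IsThresholdQuantizer δ m Q)

include hQ

theorem Z_le (P : BMS) : P.Z ≤ (Q P).Z := by
  rcases lt_or_ge P.Z δ with h | h
  · rw [hQ.eq_bec P h, Z_bec]
  · exact (hQ.degradesTo P h).Z_le

theorem T_le (P : BMS) : (Q P).T ≤ P.T := by
  rcases lt_or_ge P.Z δ with h | h
  · have := (isErasure_bec P.Z P.Z_nonneg P.Z_le_one).T_add_Z
    rw [Z_bec] at this
    rw [hQ.eq_bec P h]
    linarith [P.one_le_T_add_Z]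
  · exact (hQ.degradesTo P h).T_le

theorem isErasure_of_lt {P : BMS} (h : P.Z < δ) : (Q P).IsErasure := by
  rw [hQ.eq_bec P h]
  exact isErasure_bec _ _ _

theorem avg_eq {Φ : ℝ → ℝ → ℝ} (hΦ : IsConcaveHomog Φ) {P : BMS} [Finite P.Y] (h : δ ≤ P.Z)
    (hm : P.masses.length ≤ m) : (Q P).avg Φ = P.avg Φ := by
  rw [hQ.eq_ofMasses P h hm, avg_ofMasses _ _ hΦ, P.avg_eq_massSum_masses hΦ]

theorem I_eq {P : BMS} [Finite P.Y] (h : δ ≤ P.Z) (hm : P.masses.length ≤ m) :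
    (Q P).I = P.I := by
  have := hQ.avg_eq isConcaveHomog_neg_capacityDensity h hm
  rwa [avg_neg, avg_neg, ← I_eq_avg, ← I_eq_avg, neg_inj] at this

section Erasure

variable {P : BMS} [Finite P.Y] (hP : P.IsErasure) (hm : 2 ≤ m)

include hP hm

theorem isErasure : (Q P).IsErasure := by
  rcases lt_or_ge P.Z δ with h | h
  · exact hQ.isErasure_of_lt h
  · rw [hQ.eq_ofMasses P h (hP.length_masses_le.trans hm)]
    exact hP.ofMasses_masses

theorem Z_eq : (Q P).Z = P.Z := by
  rcases lt_or_ge P.Z δ with h | h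
  · rw [hQ.eq_bec P h, Z_bec]
  · exact hQ.avg_eq isConcaveHomog_sqrt h (hP.length_masses_le.trans hm)

theorem T_eq : (Q P).T = P.T := by
  linarith [hP.T_add_Z, (hQ.isErasure hP hm).T_add_Z, hQ.Z_eq hP hm]

end Erasure

theorem finite_quantSub (W : BMS) (n i : ℕ) : Finite (quantSub Q W n i).Y := by
  cases n <;> exact hQ.finite _

theorem le_Z_of_not_isErasure_quantSub {W : BMS} {n i : ℕ}
    (h : ¬ (quantSub Q W n i).IsErasure) : δ ≤ (quantSub Q W n i).Z := by
  have le_Z (P : BMS) (hP : ¬ (Q P).IsErasure) : δ ≤ (Q P).Z :=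
    (not_lt.1 fun hZ => hP (hQ.isErasure_of_lt hZ)).trans (hQ.Z_le P)
  cases n <;> exact le_Z _ h

theorem degradesTo_or_isErasure {P R : BMS} (h : P.DegradesTo R) :
    P.DegradesTo (Q R) ∨ (Q R).IsErasure ∧ P.Z ≤ (Q R).Z := by
  rcases lt_or_ge R.Z δ with hZ | hZ
  · exact .inr ⟨hQ.isErasure_of_lt hZ, h.Z_le.trans (hQ.Z_le R)⟩
  · exact .inl (h.trans (hQ.degradesTo R hZ))

-- `BEC(Z(P))` is not degraded with respect to `P`, but erasure channels maximize `Z(P⁻)` for given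
-- `Z(P)` and `Z(P⁺) = Z(P)²` always, so the inequality of the `Z`s is inherited from then on.
theorem degradesTo_or_isErasure_quantSub (hm : 2 ≤ m) (W : BMS) (n i : ℕ) :
    (W.sub n i).DegradesTo (quantSub Q W n i) ∨
      (quantSub Q W n i).IsErasure ∧ (W.sub n i).Z ≤ (quantSub Q W n i).Z := by
  induction n generalizing i with
  | zero => exact hQ.degradesTo_or_isErasure (.refl W)
  | succ n ih =>
    rcases ih (i / 2) with h | ⟨h, hZ⟩
    · exact hQ.degradesTo_or_isErasure (h.child _)
    · have := hQ.finite_quantSub W n (i / 2)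
      have hc := h.child (i % 2 == 1)
      exact .inr ⟨hQ.isErasure hc hm, (h.Z_child_le hZ _).trans (hQ.Z_eq hc hm).ge⟩

theorem admissible (hm : 2 ≤ m) : Admissible Q := fun W n i _ =>
  (hQ.degradesTo_or_isErasure_quantSub hm W n i).elim DegradesTo.Z_le And.right

end IsThresholdQuantizer

/-! ### The mass algorithms as threshold quantizers -/

open Classical in
/-- The quantization scheme that combines the mass algorithm `A` with erasure channels below the
threshold `δ`.  The crossover probabilities of a channel with infinite output alphabet, which `A`
cannot treat, are rounded to a grid of `M + 2` points. -/
def massScheme (A : MassAlgorithm) (f : ℝ → ℝ) (δ : ℝ) (k M : ℕ) (P : BMS) : BMS :=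
  if P.Z < δ then bec P.Z P.Z_nonneg P.Z_le_one
  else if _h : Finite P.Y then
    ofMasses (A.run f (k / 2) P.masses) (P.isMassList_masses.run A f (k / 2))
  else P.gridQuantize M

section massScheme

variable {A : MassAlgorithm} {f : ℝ → ℝ} {δ : ℝ} {k M : ℕ} {P : BMS}

theorem massScheme_of_lt (h : P.Z < δ) :
    massScheme A f δ k M P = bec P.Z P.Z_nonneg P.Z_le_one := if_pos h

theorem massScheme_of_finite [hf : Finite P.Y] (h : δ ≤ P.Z) : massScheme A f δ k M P =
    ofMasses (A.run f (k / 2) P.masses) (P.isMassList_masses.run A f (k / 2)) := by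
  rw [massScheme, if_neg h.not_gt, dif_pos hf]

theorem massScheme_of_not_finite (hf : ¬ Finite P.Y) (h : δ ≤ P.Z) :
    massScheme A f δ k M P = P.gridQuantize M := by
  rw [massScheme, if_neg h.not_gt, dif_neg hf]

theorem isMassBECScheme_massScheme : IsMassBECScheme A f δ k (massScheme A f δ k M) :=
  fun _ => ⟨massScheme_of_lt, fun h _ => massScheme_of_finite h⟩

theorem finite_bec (e : ℝ) (h0 : 0 ≤ e) (h1 : e ≤ 1) : Finite (bec e h0 h1).Y :=
  inferInstanceAs (Finite (Option Bool))

theorem card_bec (e : ℝ) (h0 : 0 ≤ e) (h1 : e ≤ 1) : Nat.card (bec e h0 h1).Y = 3 := by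
  change Nat.card (Option Bool) = 3
  simp

theorem finite_massScheme : Finite (massScheme A f δ k M P).Y := by
  unfold massScheme
  split_ifs
  · exact finite_bec _ _ _
  · exact finite_ofMasses _ _
  · exact finite_ofMasses _ _

theorem isQuantizer_massScheme (hk : 3 ≤ k) (hkM : 2 * (M + 2) ≤ k) :
    IsQuantizer k (massScheme A f δ k M) := by
  refine fun P => ⟨finite_massScheme, ?_⟩
  unfold massScheme
  split_ifs
  · rwa [card_bec]
  · rw [card_ofMasses]
    have := A.length_run_le f (k := k / 2) (by omega) P.masses
    omega
  · exact (P.card_gridQuantize_le M).trans hkM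

theorem card_massScheme_le [Finite P.Y] :
    Nat.card (massScheme A f δ k M P).Y ≤ 2 * Nat.card P.Y + 3 := by
  rcases lt_or_ge P.Z δ with h | h
  · rw [massScheme_of_lt h, card_bec]
    omega
  · rw [massScheme_of_finite h, card_ofMasses]
    have := A.length_run_le_length f (k / 2) P.masses
    have := P.length_masses_le
    omega

theorem card_massScheme_le_add (W : BMS) :
    Nat.card (massScheme A f δ k M W).Y ≤ 2 * Nat.card W.Y + 3 + 2 * (M + 2) := by
  by_cases hf : Finite W.Y
  · exact card_massScheme_le.trans (Nat.le_add_right _ _)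
  rcases lt_or_ge W.Z δ with h | h
  · rw [massScheme_of_lt h, card_bec]
    omega
  · rw [massScheme_of_not_finite hf h]
    exact (W.card_gridQuantize_le M).trans (Nat.le_add_left _ _)

theorem degradesTo_massScheme (h : δ ≤ P.Z) : P.DegradesTo (massScheme A f δ k M P) := by
  by_cases hf : Finite P.Y
  · rw [massScheme_of_finite h]
    intro Φ hΦ
    have hsub : Icc (0 : ℝ) (1 / 2) ⊆ Icc 0 1 := Icc_subset_Icc_right (by norm_num)
    rw [P.avg_eq_massSum_masses hΦ, avg_ofMasses _ _ hΦ]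
    exact A.massSum_le_massSum_run f (hΦ.concaveOn_bscValue.subset hsub (convex_Icc _ _))
      hΦ.monotoneOn_bscValue _ P.isMassList_masses P.pairwise_masses
  · rw [massScheme_of_not_finite hf h]
    exact P.degradesTo_gridQuantize M

theorem isThresholdQuantizer_massScheme (A : MassAlgorithm) (f : ℝ → ℝ) (δ : ℝ) (k M : ℕ) :
    IsThresholdQuantizer δ (k / 2) (massScheme A f δ k M) where
  finite _ := finite_massScheme
  card_le _ := card_massScheme_le
  eq_bec _ := massScheme_of_lt
  degradesTo _ := degradesTo_massScheme
  eq_ofMasses P _ h hm := by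
    rw [massScheme_of_finite h]
    congr
    exact A.run_of_length_le f hm

theorem abs_I_massScheme_sub_le (W : BMS) (hδ : 0 ≤ δ) {ε : ℝ} (hε : 0 ≤ ε)
    (hgrid : |(W.gridQuantize M).I - W.I| ≤ ε) (hk : Nat.card W.Y ≤ k / 2) :
    |(massScheme A f δ k M W).I - W.I| ≤ δ + ε := by
  rcases lt_or_ge W.Z δ with h | h
  · rw [massScheme_of_lt h]
    linarith [W.abs_I_bec_sub_le]
  by_cases hf : Finite W.Y
  · rw [(isThresholdQuantizer_massScheme A f δ k M).I_eq h (W.length_masses_le.trans hk), sub_self,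
      abs_zero]
    positivity
  · rw [massScheme_of_not_finite hf h]
    linarith

end massScheme

end BMS

/-! ### Averages over the levels of a binary tree -/

/-- The average of `a 0, …, a (2 ^ n - 1)`, the labels of the nodes at level `n` of a binary tree,
from left to right. -/
def levelAvg (n : ℕ) (a : ℕ → ℝ) : ℝ := (∑ i ∈ Finset.range (2 ^ n), a i) / 2 ^ n

theorem levelAvg_zero (a : ℕ → ℝ) : levelAvg 0 a = a 0 := by simp [levelAvg]

theorem sum_range_two_mul (m : ℕ) (a : ℕ → ℝ) : ∑ i ∈ Finset.range (2 * m), a i =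
    ∑ i ∈ Finset.range m, (a (2 * i) + a (2 * i + 1)) := by
  induction m with
  | zero => simp
  | succ m ih =>
    rw [show 2 * (m + 1) = 2 * m + 1 + 1 by ring, Finset.sum_range_succ, Finset.sum_range_succ,
      ih, Finset.sum_range_succ, add_assoc]

theorem levelAvg_succ (n : ℕ) (a : ℕ → ℝ) :
    levelAvg (n + 1) a = levelAvg n fun i => (a (2 * i) + a (2 * i + 1)) / 2 := by
  rw [levelAvg, levelAvg, pow_succ', sum_range_two_mul, ← Finset.sum_div, pow_succ']
  field_simp

theorem levelAvg_mono {n : ℕ} {a b : ℕ → ℝ} (h : ∀ i, a i ≤ b i) : levelAvg n a ≤ levelAvg n b :=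
  div_le_div_of_nonneg_right (Finset.sum_le_sum fun i _ => h i) (by positivity)

theorem levelAvg_const (n : ℕ) (c : ℝ) : levelAvg n (fun _ => c) = c := by
  simp [levelAvg]

theorem levelAvg_nonneg {n : ℕ} {a : ℕ → ℝ} (h : ∀ i, 0 ≤ a i) : 0 ≤ levelAvg n a :=
  (levelAvg_const n 0).ge.trans (levelAvg_mono h)

theorem levelAvg_add (n : ℕ) (a b : ℕ → ℝ) :
    levelAvg n (fun i => a i + b i) = levelAvg n a + levelAvg n b := by
  simp [levelAvg, Finset.sum_add_distrib, add_div]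

theorem levelAvg_sub (n : ℕ) (a b : ℕ → ℝ) :
    levelAvg n (fun i => a i - b i) = levelAvg n a - levelAvg n b := by
  simp [levelAvg, Finset.sum_sub_distrib, sub_div]

theorem levelAvg_const_mul (n : ℕ) (c : ℝ) (a : ℕ → ℝ) :
    levelAvg n (fun i => c * a i) = c * levelAvg n a := by
  simp [levelAvg, ← Finset.mul_sum, mul_div_assoc]

theorem abs_levelAvg_sub_le {n : ℕ} {a b c : ℕ → ℝ} (h : ∀ i, |a i - b i| ≤ c i) :
    |levelAvg n a - levelAvg n b| ≤ levelAvg n c := by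
  rw [abs_sub_le_iff, ← levelAvg_sub, ← levelAvg_sub]
  exact ⟨levelAvg_mono fun i => (abs_sub_le_iff.1 (h i)).1,
    levelAvg_mono fun i => (abs_sub_le_iff.1 (h i)).2⟩

/-! ### Polarization of numbers on a binary tree -/

/-- The squared polarization defect of a number in `[0, 1]`: it is small near `0` and near `1`
only. -/
def defect (x : ℝ) : ℝ := (x * (1 - x)) ^ 2

theorem defect_nonneg (x : ℝ) : 0 ≤ defect x := sq_nonneg _

theorem exists_le_add_mul_defect {η κ : ℝ} (hη : 0 < η) (hκ : 0 < κ) :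
    ∃ C, 0 ≤ C ∧ ∀ t ∈ Icc (0 : ℝ) 1, ∀ x ≤ 1, (t < η → x ≤ η) → (1 - t < κ → x ≤ η) →
      x ≤ η + C * defect t := by
  refine ⟨1 / (η * κ) ^ 2, by positivity, fun t ht x hx near_zero near_one => ?_⟩
  have hC : 0 ≤ 1 / (η * κ) ^ 2 * defect t := mul_nonneg (by positivity) (defect_nonneg t)
  rcases lt_or_ge t η with h | h
  · linarith [near_zero h]
  rcases lt_or_ge (1 - t) κ with h' | h'
  · linarith [near_one h']
  have hmul : η * κ ≤ t * (1 - t) := mul_le_mul h h' hκ.le ht.1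
  have one_le : 1 ≤ 1 / (η * κ) ^ 2 * defect t := by
    rw [one_div_mul_eq_div, one_le_div (by positivity)]
    exact pow_le_pow_left₀ (by positivity) hmul 2
  linarith

-- With `u = 1 - y` and `v = 1 - z`, the hypotheses read `1 - x + x (1 - x) ≤ u` and
-- `2 (1 - x) ≤ u + v`: the gap between `u` and `v` makes the mean of the squares grow.
theorem defect_le_of_le_sq {x y z : ℝ} (hx0 : 0 ≤ x) (hx1 : x ≤ 1) (hy : y ≤ x ^ 2)
    (hyz : y + z ≤ 2 * x) : defect x ≤ (1 - y) ^ 2 + (1 - z) ^ 2 - 2 * (1 - x) ^ 2 := by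
  have hJ : 0 ≤ 1 - x := sub_nonneg.2 hx1
  have hgap : x * (1 - x) ≤ 1 - y - (1 - x) := by nlinarith
  have hsq : defect x ≤ (1 - y - (1 - x)) ^ 2 := pow_le_pow_left₀ (mul_nonneg hx0 hJ) hgap 2
  rcases le_total (1 - y) (2 * (1 - x)) with hu | hu
  · have : (2 * (1 - x) - (1 - y)) ^ 2 ≤ (1 - z) ^ 2 :=
      pow_le_pow_left₀ (by linarith) (by linarith) 2
    nlinarith [sq_nonneg (1 - y - (1 - x))]
  · have : 2 * (1 - x) * (1 - x) ≤ (1 - y) * (1 - x) := mul_le_mul_of_nonneg_right hu hJ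
    nlinarith [sq_nonneg (1 - z)]

/-- A labelling `t n i` of the nodes of a binary tree that satisfies the relations between the
total variation distances of a channel and of its two children. -/
structure IsPolarizing (t : ℕ → ℕ → ℝ) : Prop where
  nonneg : ∀ n i, 0 ≤ t n i
  le_one : ∀ n i, t n i ≤ 1
  left_le : ∀ n i, t (n + 1) (2 * i) ≤ t n i ^ 2
  sum_le : ∀ n i, t (n + 1) (2 * i) + t (n + 1) (2 * i + 1) ≤ 2 * t n i

namespace IsPolarizing

variable {t : ℕ → ℕ → ℝ}

theorem antitone (h : IsPolarizing t) : Antitone fun n => levelAvg n (t n) := by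
  refine antitone_nat_of_succ_le fun n => ?_
  rw [levelAvg_succ]
  exact levelAvg_mono fun i => by linarith [h.sum_le n i]

theorem levelAvg_defect_le (h : IsPolarizing t) (n : ℕ) :
    levelAvg n (fun i => defect (t n i)) ≤
      2 * (levelAvg (n + 1) (fun i => (1 - t (n + 1) i) ^ 2) -
        levelAvg n fun i => (1 - t n i) ^ 2) := by
  rw [levelAvg_succ, ← levelAvg_sub, ← levelAvg_const_mul]
  refine levelAvg_mono fun i => ?_
  linarith [defect_le_of_le_sq (h.nonneg n i) (h.le_one n i) (h.left_le n i) (h.sum_le n i)]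

theorem sum_levelAvg_defect_le (h : IsPolarizing t) (N : ℕ) :
    ∑ n ∈ Finset.range N, levelAvg n (fun i => defect (t n i)) ≤ 2 := by
  have telescope : ∑ n ∈ Finset.range N, levelAvg n (fun i => defect (t n i)) ≤
      2 * (levelAvg N (fun i => (1 - t N i) ^ 2) - levelAvg 0 fun i => (1 - t 0 i) ^ 2) := by
    rw [← Finset.sum_range_sub (fun n => levelAvg n fun i => (1 - t n i) ^ 2), Finset.mul_sum]
    exact Finset.sum_le_sum fun n _ => h.levelAvg_defect_le n
  have le_one : levelAvg N (fun i => (1 - t N i) ^ 2) ≤ 1 :=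
    (levelAvg_mono fun i => pow_le_one₀ (sub_nonneg.2 (h.le_one N i))
      (sub_le_self 1 (h.nonneg N i))).trans_eq (levelAvg_const N 1)
  have nonneg : 0 ≤ levelAvg 0 fun i => (1 - t 0 i) ^ 2 := levelAvg_nonneg fun _ => sq_nonneg _
  linarith

theorem tendsto_levelAvg_defect (h : IsPolarizing t) :
    Tendsto (fun n => levelAvg n fun i => defect (t n i)) atTop (𝓝 0) :=
  (summable_of_sum_range_le (fun _ => levelAvg_nonneg fun _ => defect_nonneg _)
    h.sum_levelAvg_defect_le).tendsto_atTop_zero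

theorem exists_levelAvg_defect_le (h : IsPolarizing t) {N : ℕ} (hN : 0 < N) :
    ∃ n < N, levelAvg n (fun i => defect (t n i)) ≤ 2 / N := by
  have hsum : ∑ n ∈ Finset.range N, levelAvg n (fun i => defect (t n i)) ≤
      ∑ _n ∈ Finset.range N, (2 / N : ℝ) := by
    rw [Finset.sum_const, Finset.card_range, nsmul_eq_mul, mul_div_cancel₀ _ (by positivity)]
    exact h.sum_levelAvg_defect_le N
  obtain ⟨n, hn, hle⟩ := Finset.exists_le_of_sum_le (Finset.nonempty_range_iff.2 hN.ne') hsum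
  exact ⟨n, Finset.mem_range.1 hn, hle⟩

end IsPolarizing

/-! ### Polarization of the quantized tree -/

namespace BMS

theorem exists_T_sub_I_le {η : ℝ} (hη : 0 < η) :
    ∃ C, 0 ≤ C ∧ ∀ P : BMS, P.T - P.I ≤ η + C * defect P.T := by
  obtain ⟨C, hC, h⟩ := exists_le_add_mul_defect hη (κ := η ^ 2 / 8) (by positivity)
  refine ⟨C, hC, fun P => h P.T ⟨P.T_nonneg, P.T_le_one⟩ _ ?_ (fun hT => ?_) fun hT => ?_⟩
  · linarith [P.T_le_one, P.I_nonneg]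
  · linarith [P.I_nonneg]
  · have hZ : P.Z < η / 2 := by
      refine lt_of_pow_lt_pow_left₀ 2 (by positivity) ?_
      nlinarith [P.sq_Z_add_sq_T_le_one, P.T_le_one, P.T_nonneg]
    linarith [P.T_le_one, P.one_sub_two_mul_Z_le_I]

open Classical in
theorem exists_abs_good_sub_T_le {η : ℝ} (hη : 0 < η) (hη' : η ≤ 1 / 2) : ∃ C, 0 ≤ C ∧
    ∀ P : BMS, |(if 1 / 2 < P.I then 1 else 0) - P.T| ≤ η + C * defect P.T := by
  obtain ⟨C, hC, h⟩ := exists_le_add_mul_defect hη (κ := η ^ 2 / 8) (by positivity)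
  refine ⟨C, hC, fun P => h P.T ⟨P.T_nonneg, P.T_le_one⟩ _ ?_ (fun hT => ?_) fun hT => ?_⟩
  · have := P.T_nonneg
    have := P.T_le_one
    split_ifs <;> rw [abs_le] <;> constructor <;> linarith
  · rw [if_neg (by linarith [P.I_le_T]), zero_sub, abs_neg, abs_of_nonneg P.T_nonneg]
    exact hT.le
  · have hZ : P.Z < 1 / 4 := by
      refine lt_of_pow_lt_pow_left₀ 2 (by positivity) ?_
      nlinarith [P.sq_Z_add_sq_T_le_one, P.T_le_one, P.T_nonneg]
    rw [if_pos (by linarith [P.one_sub_two_mul_Z_le_I]), abs_of_nonneg (sub_nonneg.2 P.T_le_one)]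
    nlinarith

theorem exists_T_le_of_le_Z {η δ : ℝ} (hη : 0 < η) (hδ : 0 < δ) :
    ∃ C, 0 ≤ C ∧ ∀ P : BMS, δ ≤ P.Z → P.T ≤ η + C * defect P.T := by
  obtain ⟨C, hC, h⟩ := exists_le_add_mul_defect hη (κ := δ ^ 2 / 2) (by positivity)
  refine ⟨C, hC, fun P hP => h P.T ⟨P.T_nonneg, P.T_le_one⟩ _ P.T_le_one le_of_lt fun hT => ?_⟩
  nlinarith [P.sq_Z_add_sq_T_le_one, P.T_le_one, P.T_nonneg, pow_le_pow_left₀ hδ.le hP 2]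

theorem isGoodFraction_of_tendsto {Q : BMS → BMS} {W : BMS} {ρ : ℝ}
    (h : IsPolarizing fun n i => (quantSub Q W n i).T)
    (hρ : Tendsto (fun n => levelAvg n fun i => (quantSub Q W n i).T) atTop (𝓝 ρ)) :
    IsGoodFraction Q W ρ := by
  classical
  have hd : Tendsto (fun n : ℕ => (levelAvg n fun i => if 1 / 2 < (quantSub Q W n i).I then 1
      else 0) - levelAvg n fun i => (quantSub Q W n i).T) atTop (𝓝 0) := by
    rw [Metric.tendsto_atTop]
    intro ε hε
    obtain ⟨C, -, hC⟩ := exists_abs_good_sub_T_le (η := min (ε / 2) (1 / 2)) (by positivity)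
      (min_le_right _ _)
    have hlim := h.tendsto_levelAvg_defect.const_mul C
    rw [mul_zero] at hlim
    obtain ⟨N, hN⟩ := eventually_atTop.1 (hlim.eventually (gt_mem_nhds (half_pos hε)))
    refine ⟨N, fun n hn => ?_⟩
    rw [dist_zero_right, Real.norm_eq_abs]
    refine (abs_levelAvg_sub_le fun i => hC (quantSub Q W n i)).trans_lt ?_
    rw [levelAvg_add, levelAvg_const, levelAvg_const_mul]
    linarith [hN n hn, min_le_left (ε / 2) (1 / 2)]
  have hsum := hd.add hρ
  simp only [sub_add_cancel, zero_add] at hsum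
  exact hsum.congr fun n => by rw [levelAvg, Finset.sum_boole]

open Classical in
/-- The total variation distance of an erasure channel, and `0` for every other channel.  Its level
averages in the quantized tree increase, whereas those of `T` decrease. -/
def erasureT (P : BMS) : ℝ := if P.IsErasure then P.T else 0

theorem erasureT_nonneg (P : BMS) : 0 ≤ P.erasureT := by
  unfold erasureT
  split_ifs
  exacts [P.T_nonneg, le_rfl]

theorem erasureT_le_T (P : BMS) : P.erasureT ≤ P.T := by
  unfold erasureT
  split_ifs
  exacts [le_rfl, P.T_nonneg]

namespace IsThresholdQuantizer

variable {δ : ℝ} {m : ℕ} {Q : BMS → BMS} (hQ : IsThresholdQuantizer δ m Q)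

include hQ

theorem isPolarizing (W : BMS) : IsPolarizing fun n i => (quantSub Q W n i).T where
  nonneg _ _ := T_nonneg _
  le_one _ _ := T_le_one _
  left_le n i := by
    rw [quantSub_even, ← T_minus]
    exact hQ.T_le _
  sum_le n i := by
    rw [quantSub_even, quantSub_odd]
    exact (add_le_add (hQ.T_le _) (hQ.T_le _)).trans (T_minus_add_T_plus_le _)

theorem monotone_levelAvg_erasureT (hm : 2 ≤ m) (W : BMS) :
    Monotone fun n => levelAvg n fun i => (quantSub Q W n i).erasureT := by
  refine monotone_nat_of_le_succ fun n => ?_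
  rw [levelAvg_succ]
  refine levelAvg_mono fun i => ?_
  rw [quantSub_even, quantSub_odd]
  have := hQ.finite_quantSub W n i
  generalize quantSub Q W n i = R at *
  by_cases hR : R.IsErasure
  · have eq_T (b : Bool) : (Q (R.child b)).erasureT = (R.child b).T := by
      rw [erasureT, if_pos (hQ.isErasure (hR.child b) hm), hQ.T_eq (hR.child b) hm]
    rw [eq_T, eq_T, erasureT, if_pos hR]
    exact ((div_eq_iff two_ne_zero).2 (hR.T_minus_add_T_plus.trans (mul_comm _ _))).ge
  · rw [erasureT, if_neg hR]
    exact div_nonneg (add_nonneg (erasureT_nonneg _) (erasureT_nonneg _)) zero_le_two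

theorem exists_isGoodFraction (hm : 2 ≤ m) (W : BMS) : ∃ ρ, IsGoodFraction Q W ρ ∧
    ∀ n, ρ ∈ Icc (levelAvg n fun i => (quantSub Q W n i).erasureT)
      (levelAvg n fun i => (quantSub Q W n i).T) := by
  have hpol := hQ.isPolarizing W
  have hmono := hQ.monotone_levelAvg_erasureT hm W
  have hle (n : ℕ) : (levelAvg n fun i => (quantSub Q W n i).erasureT) ≤
      levelAvg n fun i => (quantSub Q W n i).T := levelAvg_mono fun i => erasureT_le_T _
  have hbdd : BddBelow (range fun n => levelAvg n fun i => (quantSub Q W n i).T) :=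
    ⟨_, forall_mem_range.2 fun n => (hmono (Nat.zero_le n)).trans (hle n)⟩
  have hlim := tendsto_atTop_ciInf hpol.antitone hbdd
  exact ⟨_, isGoodFraction_of_tendsto hpol hlim, fun n =>
    ⟨ge_of_tendsto hlim (eventually_atTop.2 ⟨n, fun k hk => (hmono hk).trans (hle k)⟩),
      hpol.antitone.le_of_tendsto hlim n⟩⟩

theorem T_sub_erasureT_le {η C : ℝ} (hη : 0 ≤ η) (hC : 0 ≤ C)
    (h : ∀ P : BMS, δ ≤ P.Z → P.T ≤ η + C * defect P.T) (W : BMS) (n i : ℕ) :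
    (quantSub Q W n i).T - (quantSub Q W n i).erasureT ≤
      η + C * defect (quantSub Q W n i).T := by
  unfold erasureT
  split_ifs with hE
  · rw [sub_self]
    exact add_nonneg hη (mul_nonneg hC (defect_nonneg _))
  · rw [sub_zero]
    exact h _ (hQ.le_Z_of_not_isErasure_quantSub hE)

end IsThresholdQuantizer

-- `N` depends on `δ` and `η` only: the polarization argument provides a level `n < N` at which
-- the defects are small on average, no matter what the channels are.
theorem exists_isGoodFraction_abs_sub_levelAvg_I_le {δ η : ℝ} (hδ : 0 < δ) (hη : 0 < η) :
    ∃ N : ℕ, ∀ {m : ℕ} {Q : BMS → BMS}, IsThresholdQuantizer δ m Q → 2 ≤ m → ∀ W : BMS,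
      ∃ ρ, IsGoodFraction Q W ρ ∧
        ∃ n < N, |ρ - levelAvg n fun i => (quantSub Q W n i).I| ≤ 2 * η := by
  obtain ⟨C, hC0, hC⟩ := exists_T_sub_I_le hη
  obtain ⟨C', hC'0, hC'⟩ := exists_T_le_of_le_Z hη hδ
  obtain ⟨N, hN⟩ := exists_nat_gt (2 * (C + C') / η)
  have hN0 : (0 : ℝ) < N := lt_of_le_of_lt (by positivity) hN
  refine ⟨N, fun {m Q} hQ hm W => ?_⟩
  obtain ⟨ρ, hρ, hmem⟩ := hQ.exists_isGoodFraction hm W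
  obtain ⟨n, hn, hD⟩ := (hQ.isPolarizing W).exists_levelAvg_defect_le (Nat.cast_pos.1 hN0)
  refine ⟨ρ, hρ, n, hn, ?_⟩
  have hTI := levelAvg_mono (n := n) fun i => hC (quantSub Q W n i)
  have hTE := levelAvg_mono (n := n) fun i => hQ.T_sub_erasureT_le hη.le hC'0 hC' W n i
  have hIT := levelAvg_mono (n := n) fun i => (quantSub Q W n i).I_le_T
  rw [levelAvg_sub, levelAvg_add, levelAvg_const, levelAvg_const_mul] at hTI hTE
  have hD0 := levelAvg_nonneg (n := n) fun i => defect_nonneg (quantSub Q W n i).T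
  have hCD : (C + C') * (levelAvg n fun i => defect (quantSub Q W n i).T) ≤ η := by
    refine (mul_le_mul_of_nonneg_left hD (by positivity)).trans ?_
    rw [div_lt_iff₀ hη] at hN
    rw [← mul_div_assoc, div_le_iff₀ hN0]
    linarith
  have hCD0 := mul_nonneg hC0 hD0
  have hCD'0 := mul_nonneg hC'0 hD0
  obtain ⟨hlow, hup⟩ := hmem n
  rw [abs_le]
  constructor <;> linarith

end BMS

/-! ### Capacity lost by quantization -/

namespace BMS

open Classical in
/-- The capacity that quantization may still lose below a channel `P`: a loss, of at most `δ`,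
occurs only where an erasure channel first appears on a branch. -/
def reserve (δ : ℝ) (P : BMS) : ℝ := if P.IsErasure then 0 else δ

theorem reserve_nonneg {δ : ℝ} (hδ : 0 ≤ δ) (P : BMS) : 0 ≤ P.reserve δ := by
  unfold reserve
  split_ifs
  exacts [le_rfl, hδ]

theorem reserve_le {δ : ℝ} (hδ : 0 ≤ δ) (P : BMS) : P.reserve δ ≤ δ := by
  unfold reserve
  split_ifs
  exacts [hδ, le_rfl]

/-- A bound for the alphabet sizes at level `n` of a quantized tree whose root has at most `c`
output symbols.  It does not involve the number of symbols the quantizer allows. -/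
def cardBound (c : ℕ) : ℕ → ℕ
  | 0 => c
  | n + 1 => 2 * (2 * cardBound c n ^ 2) + 3

theorem monotone_cardBound (c : ℕ) : Monotone (cardBound c) := by
  refine monotone_nat_of_le_succ fun n => ?_
  rw [cardBound]
  nlinarith

namespace IsThresholdQuantizer

variable {δ : ℝ} {m : ℕ} {Q : BMS → BMS} (hQ : IsThresholdQuantizer δ m Q)

include hQ

theorem card_quantSub_le {W : BMS} {c : ℕ} (h : Nat.card (Q W).Y ≤ c) (n i : ℕ) :
    Nat.card (quantSub Q W n i).Y ≤ cardBound c n := by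
  induction n generalizing i with
  | zero => exact h
  | succ n ih =>
    have := hQ.finite_quantSub W n (i / 2)
    rw [quantSub, cardBound]
    have hchild := card_child_le (quantSub Q W n (i / 2)) (i % 2 == 1)
    have hpow := Nat.pow_le_pow_left (ih (i / 2)) 2
    exact (hQ.card_le _).trans (by omega)

theorem abs_I_child_sub_add_reserve_le (hδ : 0 ≤ δ) (hm : 2 ≤ m) {R : BMS} [Finite R.Y] {b : Bool}
    (hR : (R.child b).masses.length ≤ m) :
    |(Q (R.child b)).I - (R.child b).I| + (Q (R.child b)).reserve δ ≤ R.reserve δ := by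
  by_cases hE : R.IsErasure
  · have hchild := hE.child b
    have hQE := hQ.isErasure hchild hm
    rw [hQE.I_eq_T, hchild.I_eq_T, hQ.T_eq hchild hm, sub_self, abs_zero, zero_add,
      reserve, if_pos hQE, reserve, if_pos hE]
  · rw [reserve.eq_def δ R, if_neg hE]
    rcases lt_or_ge (R.child b).Z δ with hZ | hZ
    · rw [reserve, if_pos (hQ.isErasure_of_lt hZ), hQ.eq_bec _ hZ, add_zero]
      exact (abs_I_bec_sub_le _).trans hZ.le
    · rw [hQ.I_eq hZ hR, sub_self, abs_zero, zero_add]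
      exact reserve_le hδ _

theorem abs_levelAvg_succ_I_sub_le (hδ : 0 ≤ δ) (hm : 2 ≤ m) {W : BMS} {c n : ℕ}
    (hc : Nat.card (Q W).Y ≤ c) (hn : cardBound c (n + 1) ≤ m) :
    |(levelAvg (n + 1) fun i => (quantSub Q W (n + 1) i).I) -
        levelAvg n fun i => (quantSub Q W n i).I| ≤
      (levelAvg n fun i => (quantSub Q W n i).reserve δ) -
        levelAvg (n + 1) fun i => (quantSub Q W (n + 1) i).reserve δ := by
  rw [levelAvg_succ, levelAvg_succ]
  refine (abs_levelAvg_sub_le fun i => ?_).trans_eq (levelAvg_sub n _ _)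
  rw [quantSub_even, quantSub_odd]
  have hcard := hQ.card_quantSub_le hc n i
  have := hQ.finite_quantSub W n i
  generalize quantSub Q W n i = R at *
  have hloss (b : Bool) :
      |(Q (R.child b)).I - (R.child b).I| ≤ R.reserve δ - (Q (R.child b)).reserve δ := by
    refine le_sub_iff_add_le.2 (hQ.abs_I_child_sub_add_reserve_le hδ hm ?_)
    have hchild := card_child_le R b
    have hpow := Nat.pow_le_pow_left hcard 2
    rw [cardBound] at hn
    exact (length_masses_le _).trans (by omega)
  have hI : (R.child false).I + (R.child true).I = 2 * R.I := R.I_minus_add_I_plus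
  have hfalse := abs_le.1 (hloss false)
  have htrue := abs_le.1 (hloss true)
  rw [abs_le]
  constructor <;> linarith

theorem abs_levelAvg_I_sub_add_reserve_le (hδ : 0 ≤ δ) (hm : 2 ≤ m) {W : BMS} {c n : ℕ}
    (hc : Nat.card (Q W).Y ≤ c) (hn : cardBound c n ≤ m) :
    |(levelAvg n fun i => (quantSub Q W n i).I) - (Q W).I| +
      (levelAvg n fun i => (quantSub Q W n i).reserve δ) ≤ (Q W).reserve δ := by
  induction n with
  | zero => rw [levelAvg_zero, levelAvg_zero, quantSub, sub_self, abs_zero, zero_add]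
  | succ n ih =>
    have hprev := ih ((monotone_cardBound c n.le_succ).trans hn)
    have hstep := hQ.abs_levelAvg_succ_I_sub_le hδ hm hc hn
    have htri := abs_sub_le (levelAvg (n + 1) fun i => (quantSub Q W (n + 1) i).I)
      (levelAvg n fun i => (quantSub Q W n i).I) (Q W).I
    linarith

theorem abs_levelAvg_I_sub_le (hδ : 0 ≤ δ) (hm : 2 ≤ m) {W : BMS} {c n : ℕ}
    (hc : Nat.card (Q W).Y ≤ c) (hn : cardBound c n ≤ m) :
    |(levelAvg n fun i => (quantSub Q W n i).I) - (Q W).I| ≤ δ := by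
  have h := hQ.abs_levelAvg_I_sub_add_reserve_le hδ hm hc hn
  have hnonneg := levelAvg_nonneg (n := n) fun i => reserve_nonneg hδ (quantSub Q W n i)
  linarith [reserve_le hδ (Q W)]

end IsThresholdQuantizer

end BMS

end

theorem theorem2_general (W : BMS) (A : MassAlgorithm) (f : ℝ → ℝ) (ε : ℝ) (hε : 0 < ε) :
    ∃ δ₀ : ℝ, 0 < δ₀ ∧ ∀ δ : ℝ, 0 < δ → δ ≤ δ₀ →
      ∃ K : ℕ, ∀ k : ℕ, K ≤ k →
        ∃ Q : BMS → BMS,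
          IsQuantizer k Q ∧ IsMassBECScheme A f δ k Q ∧ Admissible Q ∧
            ∃ ρ : ℝ, IsGoodFraction Q W ρ ∧ |ρ - W.I| < ε := by
  obtain ⟨M, hM⟩ := BMS.exists_abs_I_gridQuantize_sub_le (ε := ε / 8) (by positivity)
  refine ⟨ε / 8, by positivity, fun δ hδ hδε => ?_⟩
  obtain ⟨N, hN⟩ := BMS.exists_isGoodFraction_abs_sub_levelAvg_I_le hδ (η := ε / 8) (by positivity)
  set c := 2 * Nat.card W.Y + 3 + 2 * (M + 2)
  refine ⟨2 * BMS.cardBound c N, fun k hk => ?_⟩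
  have hcN : c ≤ BMS.cardBound c N := BMS.monotone_cardBound c (Nat.zero_le N)
  have hm : 2 ≤ k / 2 := by omega
  have hQ := BMS.isThresholdQuantizer_massScheme A f δ k M
  obtain ⟨ρ, hρ, n, hn, hρI⟩ := hN hQ hm W
  refine ⟨BMS.massScheme A f δ k M, BMS.isQuantizer_massScheme (by omega) (by omega),
    BMS.isMassBECScheme_massScheme, hQ.admissible hm, ρ, hρ, ?_⟩
  have hlevel := hQ.abs_levelAvg_I_sub_le hδ.le hm (n := n) (BMS.card_massScheme_le_add W)
    ((BMS.monotone_cardBound c hn.le).trans (by omega))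
  have hroot : |(BMS.massScheme A f δ k M W).I - W.I| ≤ δ + ε / 8 :=
    BMS.abs_I_massScheme_sub_le W hδ.le (by positivity) (hM W) (by omega)
  calc |ρ - W.I| ≤ 2 * (ε / 8) + (δ + (δ + ε / 8)) := (abs_sub_le _ _ _).trans
        (add_le_add hρI ((abs_sub_le _ _ _).trans (add_le_add hlevel hroot)))
    _ < ε := by linarith

theorem theorem2 (W : BMS) (A : MassAlgorithm) (f : ℝ → ℝ)
    (hf : MonotoneOn f (Set.Icc 0 (1 / 2)))
    (hfc : A = MassAlgorithm.merging → ConcaveOn ℝ (Set.Icc 0 (1 / 2)) f)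
    (ε : ℝ) (hε : 0 < ε) :
    ∃ δ₀ : ℝ, 0 < δ₀ ∧ ∀ δ : ℝ, 0 < δ → δ ≤ δ₀ →
      ∃ K : ℕ, ∀ k : ℕ, K ≤ k →
        ∃ Q : BMS → BMS,
          IsQuantizer k Q ∧ IsMassBECScheme A f δ k Q ∧ Admissible Q ∧
            ∃ ρ : ℝ, IsGoodFraction Q W ρ ∧ |ρ - W.I| < ε :=
  theorem2_general W A f ε hε
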